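/- \textbf{Conventions.} Strings are finite words over $\{0,1\}$, $|x|$ is the length of $x$, $\lambda$ the empty string, $x^{-1}$ the reversal of $x$, and $S\upharpoonright n$ the length-$n$ prefix of a sequence $S\in\{0,1\}^{\omega}$. $K$ is plain Kolmogorov complexity with respect to a fixed universal machine. A \emph{pushdown compressor} (PDC) is a deterministic machine $C=(Q,\Gamma,\delta,\nu,q_0,z_0,c)$ with finite state set $Q$, stack alphabet $\Gamma=\{0,1,z_0\}$, partial transition function $\delta:Q\times(\{0,1\}\cup\{\lambda\})\times\Gamma\to Q\times\Gamma^*$ and output function $\nu:Q\times(\{0,1\}\cup\{\lambda\})\times\Gamma\to\{0,1\}^*$. It starts in $q_0$ with stack $z_0$. A transition replaces the topmost stack symbol by a string, and $z_0$ is never removed. For each $(q,a)\in Q\times\Gamma$, either $\delta(q,\lambda,a)$ is undefined or both $\delta(q,0,a)$ and $\delta(q,1,a)$ are. A $\lambda$-transition pops the topmost symbol and outputs nothing, and at most $c$ of them can occur in succession; they are performed whenever possible, at the start and after each input bit. $C(x)$ is the output on input $x$. $C$ is \emph{information lossless} if it processes every string to its end and $x\mapsto(C(x),\text{final state of }C\text{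 on }x)$ is injective. A UPDC is defined in the same way with $\Gamma=\{0,z_0\}$. The information lossless PDCs and UPDCs form the classes ILPDC and ILUPDC. Put $$\rho_{\mathrm{UPD}}(S)=\inf_{C\in\mathrm{ILUPDC}}\liminf_{n\to\infty}\frac{|C(S\upharpoonright n)|}{n},\qquad R_{\mathrm{PD}}(S)=\inf_{C\in\mathrm{ILPDC}}\limsup_{n\to\infty}\frac{|C(S\upharpoonright n)|}{n}.$$ For $\alpha>0$, $\mathrm{PD\text{-}depth}(S)\ge\alpha$ means that for every $C\in\mathrm{ILUPDC}$ there is $C'\in\mathrm{ILPDC}$ with $|C(S\upharpoonright n)|-|C'(S\upharpoonright n)|\ge\alpha n$ for all but finitely many $n$. A finite-state transducer (FST) $T$ has states $q_1,\dots,q_m$, an initial state $q_i$, a transition function $\delta$ and an output function $\nu:\{q_1,\dots,q_m\}\times\{0,1\}\to\{0,1\}^*$; $T(x)$ is its output on $x$. Its \emph{size} is the least length of a description of $T$. Here a description is a string $d(\mathrm{bin}(i))\,01\,\pi$, where $\mathrm{bin}(n)$ is $n\geq 1$ in binary, $d$ doubles every bit, and $\pi$ is the concatenation, in the order $(q_1,0),(q_1,1),(q_2,0),\dots,(q_m,1)$,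 of the codes of the transitions. With $x^{\dagger}=x_10x_20\cdots x_{l-1}0x_l1$ for $x=x_1\cdots x_l$, the code of $(q,b)$ is the bitwise complement of $(1\,\nu(q,b))^{\dagger}$, preceded by $\mathrm{bin}(n)^{\dagger}$ for some $n\ge1$ with $\delta(q,b)=q_{1+(n\bmod m)}$ if $\delta(q,b)\ne q$. $D^k(x)$ is the least $|y|$ such that $T(y)=x$ for some FST $T$ of size at most $k$ ($\infty$ if there is none). For $\alpha>0$, $\mathrm{FS\text{-}depth}(S)\ge\alpha$ means that for every $k\in\mathbb N$ there is $k'\in\mathbb N$ with $D^k(S\upharpoonright n)-D^{k'}(S\upharpoonright n)\ge\alpha n$ for infinitely many $n$ (an undefined difference $\infty-\infty$ does not satisfy the inequality); otherwise $\mathrm{FS\text{-}depth}(S)<\alpha$. \textbf{Theorem.} For every $0<\beta<1/2$ there is a sequence $S\in\{0,1\}^{\omega}$ with $$\mathrm{PD\text{-}depth}(S)\ge \tfrac12-\beta\qquad\text{and}\qquad \mathrm{FS\text{-}depth}(S)<\beta .$$ Moreover, $S$ can be chosen so that, for some integer $k>8$ with $8/k\le\beta$ and some strings $R_0,R_1,R_2,\dots$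 with $|R_j|\to\infty$: \begin{itemize} \item $S$ is the infinite concatenation of the blocks $R_j1^kR_j^{-1}$, $j=0,1,2,\dots$; \item for every $j$, $R_j$ does not contain $1^k$ as a substring, and $K(R_j)\ge|R_j|\left(1-\frac1k\right)$; \item $\rho_{\mathrm{UPD}}(S)>1-\frac6k$ and $R_{\mathrm{PD}}(S)\le\frac12$. \end{itemize} -/

import Mathlib

open Filter
open scoped ENNReal

/-! ### Sequences, prefixes, blocks -/

/-- The prefix `S ↾ n` of length `n` of the infinite binary sequence `S`. -/
def seqPrefix (S : ℕ → Bool) (n : ℕ) : List Bool := (List.range n).map S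

/-- The block `R 1^k R⁻¹`, where `R⁻¹` is the reversal of `R`. -/
def flagBlock (k : ℕ) (R : List Bool) : List Bool :=
  R ++ List.replicate k true ++ R.reverse

/-- `S` is the infinite concatenation `B 0 B 1 B 2 ⋯` of the strings `B j`. -/
def IsConcatenation (S : ℕ → Bool) (B : ℕ → List Bool) : Prop :=
  Tendsto (fun J => ((List.range J).flatMap B).length) atTop atTop ∧
    ∀ J, seqPrefix S ((List.range J).flatMap B).length = (List.range J).flatMap B

/-! ### Plain Kolmogorov complexity -/

/-- A universal machine: on input `1^e 0 y` it runs the `e`-th program on `y`. -/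
def universalMachine (p : List Bool) : Part (List Bool) :=
  (Nat.Partrec.Code.eval
      (Denumerable.ofNat Nat.Partrec.Code (p.takeWhile id).length)
      (Encodable.encode (p.dropWhile id).tail)).bind
    fun r => ((Encodable.decode r : Option (List Bool)) : Part (List Bool))

theorem universalMachine_universal (V : List Bool →. List Bool) (hV : Partrec V) :
    ∃ e : ℕ, ∀ y, universalMachine (List.replicate e true ++ false :: y) = V y := by
  obtain ⟨c, hc⟩ := Nat.Partrec.Code.exists_code.1 hV
  refine ⟨Encodable.encode c, fun y => ?_⟩
  have h1 : ∀ e : ℕ, ((List.replicate e true ++ false :: y).takeWhile id).length = e := by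
    intro e
    induction e with
    | zero => simp
    | succ n ih => simp [List.replicate_succ]
  have h2 : ∀ e : ℕ, ((List.replicate e true ++ false :: y).dropWhile id).tail = y := by
    intro e
    induction e with
    | zero => simp
    | succ n ih => simp [List.replicate_succ]
  unfold universalMachine
  rw [h1, h2, Denumerable.ofNat_encode, hc]
  simp only [Encodable.encodek, Part.coe_some, Part.bind_some]
  exact Part.ext fun a => by simp

/-- Plain Kolmogorov complexity. -/
noncomputable def plainComplexity (x : List Bool) : ℕ∞ :=
  ⨅ (y : List Bool) (_ : x ∈ universalMachine y), (y.length : ℕ∞)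

/-! ### Finite-state transducers and `k`-finite-state complexity -/

/-- A finite-state transducer, with states `q_1, …, q_m` indexed by `Fin m`. -/
structure FST where
  m : ℕ
  init : Fin m
  step : Fin m → Bool → Fin m
  out : Fin m → Bool → List Bool

namespace FST

/-- The output of `T` when it reads a string starting in state `q`. -/
def runFrom (T : FST) : Fin T.m → List Bool → List Bool
  | _, [] => []
  | q, b :: x => T.out q b ++ T.runFrom (T.step q b) x

/-- The output `T(x)`. -/
def run (T : FST) (x : List Bool) : List Bool := T.runFrom T.init x

end FST

/-- `bin(n)`: the binary representation of `n`, most significant bit first. -/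
def binRep (n : ℕ) : List Bool := n.bits.reverse

/-- `d(x)`: every bit of `x` doubled. -/
def doubleBits (x : List Bool) : List Bool := x.flatMap fun b => [b, b]

/-- `x† = x₁ 0 x₂ 0 ⋯ x_{l-1} 0 x_l 1`. -/
def daggerCode : List Bool → List Bool
  | [] => []
  | [b] => [b, true]
  | b :: c :: x => b :: false :: daggerCode (c :: x)

/-- `x◇`: the bitwise complement of `(1x)†`. -/
def diamondCode (x : List Bool) : List Bool := (daggerCode (true :: x)).map not

namespace FST

/-- The code of the transition from `q` on `b` whose target is given by the number `n`:
`bin(n)‡` (empty for a loop, `bin(n)†` otherwise) followed by `ν(q,b)◇`. -/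
def transitionCode (T : FST) (q : Fin T.m) (b : Bool) (n : ℕ) : List Bool :=
  (if T.step q b = q then [] else daggerCode (binRep n)) ++ diamondCode (T.out q b)

/-- `y` encodes the transition table of `T`. With zero-based states, the number `n q b ≥ 1`
points to the state of index `n q b mod m`. -/
def IsTableCode (T : FST) (y : List Bool) : Prop :=
  ∃ n : Fin T.m → Bool → ℕ,
    (∀ q b, 1 ≤ n q b ∧ (T.step q b : ℕ) = n q b % T.m) ∧
    y = (List.finRange T.m).flatMap fun q =>
      T.transitionCode q false (n q false) ++ T.transitionCode q true (n q true)

/-- `σ(x) = T` for the fixed binary representation `σ`: `x = d(bin(i)) 01 y`, where `q_i`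
(one-based) is the initial state of `T` and `y` encodes its transition table. -/
def IsDescription (T : FST) (x : List Bool) : Prop :=
  ∃ y, T.IsTableCode y ∧
    x = doubleBits (binRep ((T.init : ℕ) + 1)) ++ [false, true] ++ y

/-- The size `|T|`: the least length of a description of `T`. -/
noncomputable def size (T : FST) : ℕ∞ :=
  ⨅ (x : List Bool) (_ : T.IsDescription x), (x.length : ℕ∞)

end FST

/-- `k`-finite-state complexity: the least length of an input on which some transducer of size
at most `k` outputs `x` (`⊤` if there is none). -/
noncomputable def fsComplexity (k : ℕ) (x : List Bool) : ℕ∞ :=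
  ⨅ (y : List Bool) (_ : ∃ T : FST, T.size ≤ k ∧ T.run y = x), (y.length : ℕ∞)

/-- `FS-depth(S) ≥ α`. The difference is taken in the extended reals; `⊤ - a = ⊤` for finite
`a`, while the undefined difference `⊤ - ⊤` counts as failing the inequality. -/
def FSDepthGE (S : ℕ → Bool) (α : ℝ) : Prop :=
  ∀ k : ℕ, ∃ k' : ℕ, ∃ᶠ n : ℕ in atTop,
    ((α * n : ℝ) : EReal) ≤
      (((fsComplexity k (seqPrefix S n) : ℕ∞) : ℝ≥0∞) : EReal) -
        (((fsComplexity k' (seqPrefix S n) : ℕ∞) : ℝ≥0∞) : EReal)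

/-! ### Pushdown compressors -/

/-- The stack alphabet: the symbols of `A` and the bottom symbol `z₀`. -/
inductive StackSymbol (A : Type) where
  | bottom : StackSymbol A
  | sym : A → StackSymbol A

/-- One transition of a (partial) transition function on a configuration (state, stack), the
topmost symbol of the stack coming first; the input `none` stands for `λ`. -/
def pushdownStep {Q A : Type}
    (δ : Q → Option Bool → StackSymbol A → Option (Q × List (StackSymbol A)))
    (b : Option Bool) : Q × List (StackSymbol A) → Option (Q × List (StackSymbol A))
  | (_, []) => none
  | (q, a :: v) => (δ q b a).map fun r => (r.1, r.2 ++ v)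

/-- A pushdown compressor with stack alphabet `A ∪ {z₀}`; `none` as a value of `δ` is `⊥`.
By `bottom_kept` a symbol `z₀`, wherever it lies, is never removed from the stack. -/
structure PushdownCompressor (A : Type) where
  Q : Type
  finite : Finite Q
  δ : Q → Option Bool → StackSymbol A → Option (Q × List (StackSymbol A))
  ν : Q → Option Bool → StackSymbol A → List Bool
  q₀ : Q
  c : ℕ
  bottom_kept : ∀ q b q' w, δ q b StackSymbol.bottom = some (q', w) →
    ∃ v, w = v ++ [StackSymbol.bottom]
  lambda_pops : ∀ q a q' w, δ q none a = some (q', w) → w = []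
  deterministic : ∀ q a, δ q none a = none ∨ ∀ b : Bool, δ q (some b) a = none
  lambda_bound : ∀ s : Q × List (StackSymbol A),
    (fun o : Option (Q × List (StackSymbol A)) => o.bind (pushdownStep δ none))^[c + 1]
      (some s) = none
  lambda_silent : ∀ q a, ν q none a = []

namespace PushdownCompressor

variable {A : Type}

/-- Perform `λ`-transitions as long as possible, but at most `n` of them. -/
def lambdaClose (C : PushdownCompressor A) :
    ℕ → C.Q × List (StackSymbol A) → C.Q × List (StackSymbol A)
  | 0, s => s
  | n + 1, s =>
    match pushdownStep C.δ none s with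
    | none => s
    | some s' => C.lambdaClose n s'

/-- Read the bit `b` in the configuration `s.1` with the output `s.2` written so far, then
perform all available `λ`-transitions. -/
def readBit (C : PushdownCompressor A) (s : (C.Q × List (StackSymbol A)) × List Bool)
    (b : Bool) : Option ((C.Q × List (StackSymbol A)) × List Bool) :=
  match s with
  | ((_, []), _) => none
  | ((q, a :: v), w) =>
    (pushdownStep C.δ (some b) (q, a :: v)).map fun s' =>
      (C.lambdaClose C.c s', w ++ C.ν q (some b) a)

/-- The computation on input `x`: the final configuration and the output, or `none` if the
computation gets stuck. -/
def run (C : PushdownCompressor A) (x : List Bool) :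
    Option ((C.Q × List (StackSymbol A)) × List Bool) :=
  x.foldlM C.readBit (C.lambdaClose C.c (C.q₀, [StackSymbol.bottom]), [])

/-- The output `C(x)` (the empty string if the computation gets stuck, which never happens
for an information lossless compressor). -/
def output (C : PushdownCompressor A) (x : List Bool) : List Bool :=
  ((C.run x).map fun r => r.2).getD []

/-- `C` is information lossless: every input is processed to its end, and it is determined by
the output together with the final state. -/
def IsLossless (C : PushdownCompressor A) : Prop :=
  (∀ x, (C.run x).isSome) ∧
    Function.Injective fun x => (C.run x).map fun r => (r.2, r.1.1)

end PushdownCompressor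

/-- Pushdown compressors, with stack alphabet `{0, 1, z₀}`. -/
abbrev PDC := PushdownCompressor Bool

/-- Unary-stack pushdown compressors, with stack alphabet `{0, z₀}`. -/
abbrev UPDC := PushdownCompressor Unit

/-- `PD-depth(S) ≥ α`. -/
def PDDepthGE (S : ℕ → Bool) (α : ℝ) : Prop :=
  ∀ C : UPDC, C.IsLossless → ∃ C' : PDC, C'.IsLossless ∧ ∀ᶠ n : ℕ in atTop,
    α * n ≤ ((C.output (seqPrefix S n)).length : ℝ) - ((C'.output (seqPrefix S n)).length : ℝ)

/-- `ρ_UPD(S)`: the best-case compression ratio of `S` for lossless unary-stack compressors. -/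
noncomputable def rhoUPD (S : ℕ → Bool) : ℝ≥0∞ :=
  ⨅ (C : UPDC) (_ : C.IsLossless),
    liminf (fun n : ℕ => ((C.output (seqPrefix S n)).length : ℝ≥0∞) / (n : ℝ≥0∞)) atTop

/-- `R_PD(S)`: the worst-case compression ratio of `S` for lossless pushdown compressors. -/
noncomputable def upperRatioPD (S : ℕ → Bool) : ℝ≥0∞ :=
  ⨅ (C : PDC) (_ : C.IsLossless),
    limsup (fun n : ℕ => ((C.output (seqPrefix S n)).length : ℝ≥0∞) / (n : ℝ≥0∞)) atTop

/-! ### Finite sets of strings -/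

/-! Take k = 2L with L large compared with 1/β. The sequence separates the models because a pushdown
stack can compare a block R 1^k R⁻¹ with its own mirror image, while a counter or a finite memory
cannot. The strings R_j are obtained by counting: the words available for R_j outnumber the
descriptions shorter than `codeLength` by a factor of at least 2^(j+1) (`le_card_candidateWords`).
Hence R_j can avoid the outputs of the universal machine on all short programs. It can also avoid,
from some j on, everything that each of countably many decoders produces from a short input and
O(j²) values of advice (`exists_avoiding`, `exists_incompressible_words`). The decoders are
arbitrary functions, so their computability never matters.

Unary compressors: what lies below the topmost z₀ is never seen again, so a configuration is a state
and a counter, and the counter is linear in the input read (`exists_counterMachine`). By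
losslessness, R_j is recovered from the output on it, the two end states and the counter
(`decode_outFrom`). R_j starts at a position O(j²), so the counter is admissible advice, and the
output on R_j, and likewise on its reversal, has length at least `codeLength`. Summation gives (1 -
1/L)n for every unary compressor.

Transducers: a factor of an output is fixed by the starting state, the input and a position, and the
position is again O(j²) (`needs_of_factor`). These costs add up to one unit per cut
(`Needs.append`), so every transducer needs inputs of length (1 - 1/L)n for all large n. The
identity needs only n, so FS-depth is at most 1/L < β (`not_FSDepthGE`).

Pushdown compressors: `palCompressor` copies and pushes R, recognises the flag, and while popping
writes one bit per v matches. Blocks grow linearly and their total quadratically, so flags and an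
unfinished block are negligible and the ratio is at most 1/2 + 1/v
(`palCompressor_eventually_length_le`). Taking v = L gives the PD-depth, and v → ∞ gives the upper
ratio 1/2. -/

/-- The strings of length `n`. -/
def wordsOfLength (n : ℕ) : Finset (List Bool) :=
  (Finset.univ : Finset (Fin n → Bool)).image List.ofFn

theorem mem_wordsOfLength {n : ℕ} {x : List Bool} : x ∈ wordsOfLength n ↔ x.length = n := by
  constructor
  · intro h
    obtain ⟨f, -, rfl⟩ := Finset.mem_image.1 h
    simp
  · rintro rfl
    exact Finset.mem_image.2 ⟨x.get, Finset.mem_univ _, List.ofFn_get x⟩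

theorem card_wordsOfLength (n : ℕ) : (wordsOfLength n).card = 2 ^ n := by
  rw [wordsOfLength, Finset.card_image_of_injective _ List.ofFn_injective]
  simp

/-- The strings of length less than `n`. -/
def wordsShorter (n : ℕ) : Finset (List Bool) := (Finset.range n).biUnion wordsOfLength

theorem mem_wordsShorter {n : ℕ} {x : List Bool} : x ∈ wordsShorter n ↔ x.length < n := by
  simp [wordsShorter, mem_wordsOfLength]

theorem card_wordsShorter_le (n : ℕ) : (wordsShorter n).card ≤ 2 ^ n := by
  refine Finset.card_biUnion_le.trans ?_
  simp only [card_wordsOfLength]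
  exact (Nat.geomSum_lt (le_refl 2) (fun k hk => Finset.mem_range.1 hk)).le

/-! ### Strings without long runs of ones -/

/-- Concatenations of `M` words of length `L`, none of which consists of ones only. -/
def runFreeWords (L : ℕ) : ℕ → Finset (List Bool)
  | 0 => {[]}
  | M + 1 => ((wordsOfLength L).erase (List.replicate L true) ×ˢ runFreeWords L M).image
      fun z => z.1 ++ z.2

theorem length_of_mem_runFreeWords {L : ℕ} : ∀ {M : ℕ} {x : List Bool},
    x ∈ runFreeWords L M → x.length = L * M
  | 0, x, h => by simp_all [runFreeWords]
  | M + 1, x, h => by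
    obtain ⟨⟨w, y⟩, hz, rfl⟩ := Finset.mem_image.1 h
    obtain ⟨hw, hy⟩ := Finset.mem_product.1 hz
    have h1 := mem_wordsOfLength.1 (Finset.mem_of_mem_erase hw)
    have h2 := length_of_mem_runFreeWords hy
    simp only at h1 h2
    simp [h1, h2]
    ring

theorem card_runFreeWords (L M : ℕ) : (runFreeWords L M).card = (2 ^ L - 1) ^ M := by
  induction M with
  | zero => simp [runFreeWords]
  | succ M ih =>
    rw [runFreeWords, Finset.card_image_of_injOn, Finset.card_product, ih,
      Finset.card_erase_of_mem, card_wordsOfLength, pow_succ']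
    · simp [mem_wordsOfLength]
    · rintro ⟨w, y⟩ hz ⟨w', y'⟩ hz' h
      have hz := Finset.mem_product.1 (Finset.mem_coe.1 hz)
      have hz' := Finset.mem_product.1 (Finset.mem_coe.1 hz')
      have h1 := mem_wordsOfLength.1 (Finset.mem_of_mem_erase hz.1)
      have h2 := mem_wordsOfLength.1 (Finset.mem_of_mem_erase hz'.1)
      simp only at h1 h2 h
      obtain ⟨rfl, rfl⟩ := List.append_inj h (h1.trans h2.symm)
      rfl

theorem runFreeWords_no_prefix {L M : ℕ} (hL : 0 < L) {x : List Bool}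
    (hx : x ∈ runFreeWords L M) : ¬ List.replicate L true <+: x := by
  intro h
  cases M with
  | zero =>
    simp only [runFreeWords, Finset.mem_singleton] at hx
    subst hx
    have := h.length_le
    simp at this
    omega
  | succ M =>
    obtain ⟨⟨w, y⟩, hz, rfl⟩ := Finset.mem_image.1 hx
    obtain ⟨hw, -⟩ := Finset.mem_product.1 hz
    obtain ⟨hne, hw⟩ := Finset.mem_erase.1 hw
    have h1 := mem_wordsOfLength.1 hw
    have h2 := List.prefix_iff_eq_take.1 h
    apply hne
    simpa [h1] using h2.symm

/-- A run of 2L ones that crosses the end of the first word has at most L ones inside it, so the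
remaining words would begin with L ones, which `runFreeWords_no_prefix` excludes. -/
theorem runFreeWords_no_infix {L : ℕ} (hL : 0 < L) : ∀ {M : ℕ} {x : List Bool},
    x ∈ runFreeWords L M → ¬ List.replicate (2 * L) true <:+: x
  | 0, x, hx, h => by
    simp only [runFreeWords, Finset.mem_singleton] at hx
    subst hx
    have := h.length_le
    simp at this
    omega
  | M + 1, x, hx, h => by
    obtain ⟨⟨w, y⟩, hz, rfl⟩ := Finset.mem_image.1 hx
    obtain ⟨hw, hy⟩ := Finset.mem_product.1 hz
    obtain ⟨hne, hw⟩ := Finset.mem_erase.1 hw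
    have h1 := mem_wordsOfLength.1 hw
    simp only at h1 hne hy h
    rcases List.infix_append_iff.1 h with h | h | ⟨l, r, he, hl, hr⟩
    · have := h.length_le
      simp at this
      omega
    · exact runFreeWords_no_infix hL hy h
    · obtain ⟨hlen, hl', hr'⟩ := List.replicate_eq_append_iff.1 he
      have hll := hl.length_le
      rw [hr'] at hr
      rw [hl'] at hl
      by_cases hrl : L ≤ r.length
      · refine runFreeWords_no_prefix hL hy (List.IsPrefix.trans ?_ hr)
        refine ⟨List.replicate (r.length - L) true, ?_⟩
        rw [List.replicate_append_replicate]
        congr 1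
        omega
      · omega

/-- The candidates for the `j`-th random string. -/
def candidateWords (L j : ℕ) : Finset (List Bool) :=
  (runFreeWords L (4 * (j + 2))).image fun x => x ++ [false]

/-- The length of the `j`-th random string. -/
def blockLength (L j : ℕ) : ℕ := 4 * L * (j + 2) + 1

/-- The least length allowed for a description of the `j`-th random string. -/
def codeLength (L j : ℕ) : ℕ := (4 * L - 2) * (j + 2) + 1

theorem length_of_mem_candidateWords {L j : ℕ} {x : List Bool} (hx : x ∈ candidateWords L j) :
    x.length = blockLength L j := by
  obtain ⟨y, hy, rfl⟩ := Finset.mem_image.1 hx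
  simp [length_of_mem_runFreeWords hy, blockLength]
  ring

theorem candidateWords_no_infix {L j : ℕ} (hL : 0 < L) {x : List Bool}
    (hx : x ∈ candidateWords L j) : ¬ List.replicate (2 * L) true <:+: x := by
  obtain ⟨y, hy, rfl⟩ := Finset.mem_image.1 hx
  intro h
  have hno := runFreeWords_no_infix hL hy
  rcases List.infix_append_iff.1 h with h | h | ⟨l, r, he, hl, hr⟩
  · exact hno h
  · have := h.mem (a := true) (by simp; omega)
    simp at this
  · obtain ⟨hlen, hl', hr'⟩ := List.replicate_eq_append_iff.1 he
    have : r.length = 0 := by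
      by_contra h0
      have := hr.mem (a := true) (by rw [hr']; exact List.mem_replicate.2 ⟨h0, rfl⟩)
      simp at this
    apply hno
    rw [show 2 * L = l.length by omega, ← hl']
    exact hl.isInfix

/-- The final 0 keeps the flag from merging with ones at the end of R, so the compressor sees the
flag exactly where it starts. -/
theorem candidateWords_ends_false {L j : ℕ} {x : List Bool}
    (hx : x ∈ candidateWords L j) : ∃ y, x = y ++ [false] := by
  obtain ⟨y, -, rfl⟩ := Finset.mem_image.1 hx
  exact ⟨y, rfl⟩

theorem le_card_candidateWords {L : ℕ} (hL : 3 ≤ L) (j : ℕ) :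
    2 ^ ((4 * L - 1) * (j + 2)) ≤ (candidateWords L j).card := by
  rw [candidateWords, Finset.card_image_of_injective _ (List.append_left_injective _),
    card_runFreeWords, pow_mul, pow_mul]
  refine Nat.pow_le_pow_left ?_ _
  have h8 : 2 ^ 3 ≤ 2 ^ L := Nat.pow_le_pow_right (by norm_num) hL
  have e : 2 ^ (4 * L - 1) * 2 = (2 ^ L) ^ 4 := by
    rw [← pow_succ, ← pow_mul]
    congr 1
    omega
  generalize 2 ^ L = X at *
  obtain ⟨Y, rfl⟩ : ∃ Y, X = Y + 1 := ⟨X - 1, by omega⟩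
  -- Four words lose at most one bit: 1 - 2^(-L) ≥ 7/8 for L ≥ 3, and (7/8)^4 > 1/2.
  have h1 : (7 * (Y + 1)) ^ 4 ≤ (8 * Y) ^ 4 := Nat.pow_le_pow_left (by omega) 4
  rw [mul_pow, mul_pow, ← e] at h1
  simp only [Nat.add_sub_cancel]
  have : 0 ≤ 2 ^ (4 * L - 1) := Nat.zero_le _
  omega

/-! ### Choosing strings outside small sets -/

/-- A diagonal argument with a union bound: requirement n gets the share 2^(-(n+2)) of G j and is
imposed only at stages j > n where its bad set fits. The shares sum to less than 1/2, and B₀ takes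
at most the other half. -/
theorem exists_avoiding {ι : Type*} [Countable ι] [Nonempty ι]
    (G B₀ : ℕ → Finset (List Bool)) (B : ι → ℕ → Finset (List Bool))
    (hG : ∀ j, 0 < (G j).card) (h₀ : ∀ j, 2 * (B₀ j).card ≤ (G j).card)
    (hB : ∀ i, ∀ c : ℕ, ∀ᶠ j in atTop, c * (B i j).card ≤ (G j).card) :
    ∃ R : ℕ → List Bool, (∀ j, R j ∈ G j ∧ R j ∉ B₀ j) ∧ ∀ i, ∀ᶠ j in atTop, R j ∉ B i j := by
  classical
  obtain ⟨e, he⟩ := exists_surjective_nat ι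
  let I : ℕ → Finset ℕ := fun j =>
    (Finset.range j).filter fun n => 2 ^ (n + 2) * (B (e n) j).card ≤ (G j).card
  let U : ℕ → Finset (List Bool) := fun j => B₀ j ∪ (I j).biUnion fun n => B (e n) j
  have key : ∀ j, ∃ x ∈ G j, x ∉ U j := by
    intro j
    refine Finset.exists_mem_notMem_of_card_lt_card ?_
    have h1 : ((U j).card : ℝ) ≤ (B₀ j).card + ∑ n ∈ I j, ((B (e n) j).card : ℝ) := by
      exact_mod_cast (Finset.card_union_le _ _).trans
        (Nat.add_le_add_left Finset.card_biUnion_le _)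
    have h2 : ∑ n ∈ I j, ((B (e n) j).card : ℝ) ≤
        ∑ n ∈ Finset.range j, ((G j).card : ℝ) / 4 * (1 / 2) ^ n := by
      refine (Finset.sum_le_sum fun n hn => ?_).trans
        (Finset.sum_le_sum_of_subset_of_nonneg (Finset.filter_subset _ _)
          fun n _ _ => by positivity)
      have := (Finset.mem_filter.1 hn).2
      have h3 : (2 : ℝ) ^ (n + 2) * (B (e n) j).card ≤ (G j).card := by exact_mod_cast this
      rw [one_div, inv_pow, ← div_eq_mul_inv, le_div_iff₀ (by positivity)]
      rw [pow_add] at h3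
      linarith
    have h3 : ∑ n ∈ Finset.range j, ((G j).card : ℝ) / 4 * (1 / 2) ^ n =
        ((G j).card : ℝ) / 2 * (1 - (1 / 2) ^ j) := by
      rw [← Finset.mul_sum, geom_sum_eq (by norm_num)]
      ring
    have h4 : (2 : ℝ) * (B₀ j).card ≤ (G j).card := by exact_mod_cast h₀ j
    have h5 : (0 : ℝ) < (G j).card := by exact_mod_cast hG j
    have h6 : 0 < ((G j).card : ℝ) / 2 * (1 / 2) ^ j := by positivity
    have h7 : ((U j).card : ℝ) < (G j).card := by linarith
    exact_mod_cast h7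
  choose R hRG hRU using key
  refine ⟨R, fun j => ⟨hRG j, fun h => hRU j (Finset.mem_union_left _ h)⟩, fun i => ?_⟩
  obtain ⟨n, rfl⟩ := he i
  filter_upwards [hB (e n) (2 ^ (n + 2)), eventually_gt_atTop n] with j hj hn h
  exact hRU j (Finset.mem_union_right _ (Finset.mem_biUnion.2
    ⟨n, Finset.mem_filter.2 ⟨Finset.mem_range.2 hn, hj⟩, h⟩))

theorem eventually_quadratic_le_two_pow (c : ℕ) :
    ∀ᶠ j : ℕ in atTop, c * (j + 1) ^ 2 ≤ 2 ^ j := by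
  have h := (tendsto_pow_const_div_const_pow_of_one_lt 2 (r := (2 : ℝ)) (by norm_num)).comp
    (tendsto_add_atTop_nat 1)
  have h' := h.eventually_le_const (u := 1 / (2 * ((c : ℝ) + 1))) (by positivity)
  filter_upwards [h'] with j hj
  simp only [Function.comp_apply] at hj
  rw [div_le_div_iff₀ (by positivity) (by positivity)] at hj
  push_cast at hj
  have : (c : ℝ) * (j + 1) ^ 2 ≤ 2 ^ j := by
    rw [pow_succ (2 : ℝ)] at hj
    nlinarith [sq_nonneg ((j : ℝ) + 1)]
  exact_mod_cast this

/-- Strings of large plain complexity which are not described, with an advice of logarithmic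
length, by any of countably many given decoders. -/
theorem exists_incompressible_words {ι : Type*} [Countable ι] [Nonempty ι] {L : ℕ} (hL : 3 ≤ L)
    (D : ι → ℕ → ℕ → List Bool → List Bool) :
    ∃ R : ℕ → List Bool,
      (∀ j, R j ∈ candidateWords L j ∧ (codeLength L j : ℕ∞) ≤ plainComplexity (R j)) ∧
      ∀ i, ∀ C : ℕ, ∀ᶠ j in atTop, ∀ a < C * (j + 1) ^ 2, ∀ y : List Bool,
        D i j a y = R j ∨ D i j a y = (R j).reverse → codeLength L j ≤ y.length := by
  classical
  -- The default `[]` for diverging programs only enlarges the set to be avoided, whose size is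
  -- bounded by the number of programs anyway.
  let u : List Bool → List Bool := fun y =>
    if h : ∃ x, x ∈ universalMachine y then h.choose else []
  let P : ι × ℕ → ℕ → Finset (List Bool) := fun i j =>
    (Finset.range (i.2 * (j + 1) ^ 2) ×ˢ wordsShorter (codeLength L j)).image
      fun z => D i.1 j z.1 z.2
  -- The slack of j + 1 bits: one for the factor 2 reserved for the universal machine, while 2^j
  -- eventually beats any quadratic number of advice values.
  have e : ∀ j, codeLength L j + (j + 1) = (4 * L - 1) * (j + 2) := by
    intro j
    obtain ⟨m, hm⟩ : ∃ m, 4 * L = m + 2 := ⟨4 * L - 2, by omega⟩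
    rw [codeLength, show 4 * L - 2 = m by omega, show 4 * L - 1 = m + 1 by omega]
    ring
  have h₀ : ∀ j, 2 * ((wordsShorter (codeLength L j)).image u).card ≤
      (candidateWords L j).card := by
    intro j
    refine le_trans ?_ (le_card_candidateWords hL j)
    rw [← e j]
    calc _ ≤ 2 * 2 ^ codeLength L j :=
          Nat.mul_le_mul_left _ (Finset.card_image_le.trans (card_wordsShorter_le _))
      _ = 2 ^ (codeLength L j + 1) := by ring
      _ ≤ _ := Nat.pow_le_pow_right (by norm_num) (by omega)
  have hB : ∀ i, ∀ c : ℕ, ∀ᶠ j in atTop,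
      c * (P i j ∪ (P i j).image List.reverse).card ≤ (candidateWords L j).card := by
    intro i c
    filter_upwards [eventually_quadratic_le_two_pow (c * (2 * i.2))] with j hj
    refine le_trans ?_ (le_card_candidateWords hL j)
    have hP : (P i j).card ≤ i.2 * (j + 1) ^ 2 * 2 ^ codeLength L j := by
      refine Finset.card_image_le.trans ?_
      rw [Finset.card_product, Finset.card_range]
      exact Nat.mul_le_mul_left _ (card_wordsShorter_le _)
    have hPu : (P i j ∪ (P i j).image List.reverse).card ≤
        2 * (i.2 * (j + 1) ^ 2 * 2 ^ codeLength L j) := by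
      have h1 := Finset.card_union_le (P i j) ((P i j).image List.reverse)
      have h2 : ((P i j).image List.reverse).card ≤ (P i j).card := Finset.card_image_le
      omega
    rw [← e j]
    calc _ ≤ c * (2 * (i.2 * (j + 1) ^ 2 * 2 ^ codeLength L j)) := Nat.mul_le_mul_left _ hPu
      _ = (c * (2 * i.2) * (j + 1) ^ 2) * 2 ^ codeLength L j := by ring
      _ ≤ 2 ^ j * 2 ^ codeLength L j := Nat.mul_le_mul_right _ hj
      _ = 2 ^ (codeLength L j + j) := by ring
      _ ≤ _ := Nat.pow_le_pow_right (by norm_num) (by omega)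
  obtain ⟨R, hR₀, hR⟩ := exists_avoiding (candidateWords L)
    (fun j => (wordsShorter (codeLength L j)).image u)
    (fun i j => P i j ∪ (P i j).image List.reverse)
    (fun j => (Nat.pow_pos two_pos).trans_le (le_card_candidateWords hL j)) h₀ hB
  refine ⟨R, fun j => ⟨(hR₀ j).1, ?_⟩, fun i C => ?_⟩
  · refine le_iInf₂ fun y hy => ?_
    by_contra hlt
    refine (hR₀ j).2 (Finset.mem_image.2 ⟨y, mem_wordsShorter.2 ?_, ?_⟩)
    · exact_mod_cast not_le.1 hlt
    · have hex : ∃ x, x ∈ universalMachine y := ⟨_, hy⟩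
      simp only [u, dif_pos hex]
      exact Part.mem_unique hex.choose_spec hy
  · filter_upwards [hR (i, C)] with j hj a ha y hy
    by_contra hlt
    have hmem : D i j a y ∈ P (i, C) j := Finset.mem_image.2
      ⟨(a, y), Finset.mem_product.2 ⟨Finset.mem_range.2 ha, mem_wordsShorter.2 (not_le.1 hlt)⟩,
        rfl⟩
    apply hj
    rcases hy with hy | hy
    · exact Finset.mem_union_left _ (hy ▸ hmem)
    · exact Finset.mem_union_right _ (Finset.mem_image.2 ⟨_, hmem, by rw [hy]; simp⟩)

/-! ### Unary pushdown compressors as counter machines -/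

/-- A transducer with a counter. A transition depends on whether the counter is positive; its
value `(q, n, r)` moves to `q` and adds `n` to the decremented counter, or, if `r` holds, sets the
counter to `n`. -/
structure CounterMachine where
  N : ℕ
  step : Fin N → Option Bool → Bool → Option (Fin N × ℕ × Bool)
  out : Fin N → Bool → Bool → List Bool
  c : ℕ

instance : Countable CounterMachine := by
  let f : CounterMachine → Σ N : ℕ, (Fin N → Option Bool → Bool → Option (Fin N × ℕ × Bool)) ×
      (Fin N → Bool → Bool → List Bool) × ℕ := fun M => ⟨M.N, M.step, M.out, M.c⟩
  refine Function.Injective.countable (f := f) ?_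
  rintro ⟨N, s, o, c⟩ ⟨N', s', o', c'⟩ h
  simp only [f, Sigma.mk.injEq] at h
  obtain ⟨rfl, h⟩ := h
  simp only [heq_eq_eq, Prod.mk.injEq] at h
  obtain ⟨rfl, rfl, rfl⟩ := h
  rfl

namespace CounterMachine

variable (M : CounterMachine)

/-- One transition on a configuration (state, counter). -/
def move (b : Option Bool) (s : Fin M.N × ℕ) : Option (Fin M.N × ℕ) :=
  (M.step s.1 b (decide (0 < s.2))).map fun r => (r.1, r.2.1 + if r.2.2 then 0 else s.2 - 1)

/-- Perform `λ`-transitions as long as possible, but at most `n` of them. -/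
def close : ℕ → Fin M.N × ℕ → Fin M.N × ℕ
  | 0, s => s
  | n + 1, s =>
    match M.move none s with
    | none => s
    | some s' => close n s'

/-- Read a bit and perform all available `λ`-transitions; without a transition stand still. -/
def read (s : Fin M.N × ℕ) (b : Bool) : Fin M.N × ℕ :=
  match M.move (some b) s with
  | none => s
  | some s' => M.close M.c s'

/-- The configuration reached from `s` on a string. -/
def final (s : Fin M.N × ℕ) (x : List Bool) : Fin M.N × ℕ := x.foldl M.read s

/-- The output on a string read from configuration `s`. -/
def outFrom : Fin M.N × ℕ → List Bool → List Bool
  | _, [] => []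
  | s, b :: x => M.out s.1 b (decide (0 < s.2)) ++ outFrom (M.read s b) x

variable {M}

theorem final_append (s : Fin M.N × ℕ) (x y : List Bool) :
    M.final s (x ++ y) = M.final (M.final s x) y := List.foldl_append

theorem outFrom_append (s : Fin M.N × ℕ) (x y : List Bool) :
    M.outFrom s (x ++ y) = M.outFrom s x ++ M.outFrom (M.final s x) y := by
  induction x generalizing s with
  | nil => rfl
  | cons b x ih => simp [outFrom, ih, final]

end CounterMachine

theorem StackSymbol.unit_cases (w : List (StackSymbol Unit)) :
    (∃ n, w = List.replicate n (.sym ())) ∨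
      ∃ n r, w = List.replicate n (.sym ()) ++ .bottom :: r := by
  induction w with
  | nil => exact Or.inl ⟨0, rfl⟩
  | cons a w ih =>
    cases a with
    | bottom => exact Or.inr ⟨0, w, rfl⟩
    | sym u =>
      rcases ih with ⟨n, rfl⟩ | ⟨n, r, rfl⟩
      · exact Or.inl ⟨n + 1, rfl⟩
      · exact Or.inr ⟨n + 1, r, rfl⟩

/-- Whether a stack symbol differs from the bottom symbol. -/
def StackSymbol.isSym {A : Type} : StackSymbol A → Bool
  | .bottom => false
  | .sym _ => true

/-! ### Simulation of a unary stack by a counter -/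

namespace PushdownCompressor

/-- The top of a unary stack with or without a symbol above the topmost bottom symbol. -/
def unaryTop (t : Bool) : StackSymbol Unit := if t then .sym () else .bottom

/-- The counter machine of a unary compressor; the counter is the number of symbols above the
topmost bottom symbol. -/
abbrev toCounter (C : UPDC) {N : ℕ} (e : C.Q ≃ Fin N) : CounterMachine where
  N := N
  step p b t := (C.δ (e.symm p) b (unaryTop t)).map fun r =>
    (e r.1, (r.2.takeWhile StackSymbol.isSym).length, r.2.any fun a => !a.isSym)
  out p b t := C.ν (e.symm p) (some b) (unaryTop t)
  c := C.c

/-- The stack represents the counter. -/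
def Simulates (C : UPDC) {N : ℕ} (e : C.Q ≃ Fin N) (s : C.Q × List (StackSymbol Unit))
    (t : Fin (C.toCounter e).N × ℕ) : Prop :=
  t.1 = e s.1 ∧ ∃ r, s.2 = List.replicate t.2 (.sym ()) ++ .bottom :: r

variable {C : UPDC} {N : ℕ} {e : C.Q ≃ Fin N} {s s' : C.Q × List (StackSymbol Unit)}
  {t : Fin (C.toCounter e).N × ℕ} {b : Option Bool}

theorem Simulates.exists_top (h : C.Simulates e s t) :
    ∃ v, s.2 = unaryTop (decide (0 < t.2)) :: v := by
  obtain ⟨-, r, hr⟩ := h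
  obtain ⟨p, h⟩ := t
  cases h with
  | zero => exact ⟨r, by simpa [unaryTop] using hr⟩
  | succ h => exact ⟨_, by simpa [unaryTop, List.replicate_succ] using hr⟩

theorem Simulates.move_none (h : C.Simulates e s t) (hs : pushdownStep C.δ b s = none) :
    (C.toCounter e).move b t = none := by
  obtain ⟨v, hv⟩ := h.exists_top
  obtain ⟨q, st⟩ := s
  simp only at hv
  subst hv
  have h1 := h.1
  simp only at h1
  simp only [pushdownStep, Option.map_eq_none_iff] at hs
  simp [CounterMachine.move, toCounter, h1, hs]

/-- A pushed word without z₀ adds its length to the decremented counter. One containing z₀ buries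
the old stack for good, and only the symbols above its first z₀ count. -/
theorem Simulates.move_some (h : C.Simulates e s t) (hs : pushdownStep C.δ b s = some s') :
    ∃ t', (C.toCounter e).move b t = some t' ∧ C.Simulates e s' t' := by
  obtain ⟨q, st⟩ := s
  obtain ⟨p, n⟩ := t
  obtain ⟨h1, r, h2⟩ := h
  simp only at h1 h2
  subst h1 h2
  have hns : ∀ m : ℕ, (List.replicate m (StackSymbol.sym ())).any (fun a => !a.isSym) = false := by
    intro m
    simp [StackSymbol.isSym]
  have hts : ∀ m : ℕ, ((List.replicate m (StackSymbol.sym ())).takeWhile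
      StackSymbol.isSym).length = m := by
    intro m
    rw [List.takeWhile_replicate]
    simp [StackSymbol.isSym]
  have htb : ∀ (m : ℕ) r', ((List.replicate m (StackSymbol.sym ()) ++ StackSymbol.bottom :: r').takeWhile
      StackSymbol.isSym).length = m := by
    intro m r'
    induction m with
    | zero => simp [StackSymbol.isSym]
    | succ m ih =>
      rw [List.replicate_succ, List.cons_append, List.takeWhile_cons_of_pos rfl,
        List.length_cons, ih]
  cases n with
  | zero =>
    simp only [List.replicate_zero, List.nil_append, pushdownStep, Option.map_eq_some_iff] at hs
    obtain ⟨⟨q', w⟩, hδ, rfl⟩ := hs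
    -- With z₀ on top the pushed word must contain z₀ again, so the counter machine takes its reset
    -- branch.
    obtain ⟨v, rfl⟩ := C.bottom_kept _ _ _ _ hδ
    refine ⟨(e q', ((v ++ [StackSymbol.bottom]).takeWhile StackSymbol.isSym).length), ?_, rfl, ?_⟩
    · simp [CounterMachine.move, toCounter, unaryTop, hδ, StackSymbol.isSym]
    · rcases StackSymbol.unit_cases (v ++ [StackSymbol.bottom]) with ⟨m, hm⟩ | ⟨m, r', hm⟩
      · have : StackSymbol.bottom ∈ v ++ [StackSymbol.bottom] := by simp
        rw [hm] at this
        simp at this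
      · rw [hm]
        exact ⟨r' ++ r, by simp only [htb]; simp⟩
  | succ n =>
    simp only [List.replicate_succ, List.cons_append, pushdownStep, Option.map_eq_some_iff] at hs
    obtain ⟨⟨q', w⟩, hδ, rfl⟩ := hs
    refine ⟨(e q', (w.takeWhile StackSymbol.isSym).length +
      if w.any (fun a => !a.isSym) then 0 else n), ?_, rfl, ?_⟩
    · simp [CounterMachine.move, toCounter, unaryTop, hδ]
    rcases StackSymbol.unit_cases w with ⟨m, rfl⟩ | ⟨m, r', rfl⟩
    · refine ⟨r, ?_⟩
      simp only [hns, hts]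
      rw [← List.append_assoc, List.replicate_append_replicate]
      simp
    · refine ⟨r' ++ (List.replicate n (.sym ()) ++ .bottom :: r), ?_⟩
      simp only [htb]
      simp [StackSymbol.isSym]

theorem Simulates.lambdaClose (h : C.Simulates e s t) (n : ℕ) :
    C.Simulates e (C.lambdaClose n s) ((C.toCounter e).close n t) := by
  induction n generalizing s t with
  | zero => exact h
  | succ n ih =>
    rw [PushdownCompressor.lambdaClose, CounterMachine.close]
    cases hs : pushdownStep C.δ none s with
    | none => rw [h.move_none hs]; exact h
    | some s' =>
      obtain ⟨t', ht, h'⟩ := h.move_some hs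
      rw [ht]
      exact ih h'

theorem length_lambdaClose_le {A : Type} (C : PushdownCompressor A) (n : ℕ)
    (s : C.Q × List (StackSymbol A)) : (C.lambdaClose n s).2.length ≤ s.2.length := by
  induction n generalizing s with
  | zero => exact le_rfl
  | succ n ih =>
    rw [lambdaClose]
    cases hs : pushdownStep C.δ none s with
    | none => exact le_rfl
    | some s' =>
      refine (ih s').trans ?_
      obtain ⟨q, _ | ⟨a, v⟩⟩ := s
      · simp [pushdownStep] at hs
      · simp only [pushdownStep, Option.map_eq_some_iff] at hs
        obtain ⟨⟨q', w⟩, hδ, rfl⟩ := hs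
        rw [C.lambda_pops _ _ _ _ hδ]
        simp

theorem exists_push_bound (C : UPDC) :
    ∃ W : ℕ, ∀ q b a r, C.δ q (some b) a = some r → r.2.length ≤ W := by
  have := C.finite
  let f : C.Q × Bool × Bool → ℕ := fun z =>
    ((C.δ z.1 (some z.2.1) (unaryTop z.2.2)).map fun r => r.2.length).getD 0
  obtain ⟨W, hW⟩ := (Set.finite_range f).bddAbove
  refine ⟨W, fun q b a r h => ?_⟩
  have ha : ∃ t, a = unaryTop t := by
    cases a with
    | bottom => exact ⟨false, rfl⟩
    | sym u => exact ⟨true, rfl⟩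
  obtain ⟨t, rfl⟩ := ha
  have := hW ⟨(q, b, t), rfl⟩
  simpa [f, h] using this

/-- The height bound holds because each bit pushes at most W symbols and λ-transitions only pop. It
is what makes the number of possible counter values polynomial. -/
theorem Simulates.foldlM {W : ℕ} (hW : ∀ q b a r, C.δ q (some b) a = some r → r.2.length ≤ W)
    {s : C.Q × List (StackSymbol Unit)} {t : Fin (C.toCounter e).N × ℕ} (h : C.Simulates e s t)
    (x w : List Bool) {r : (C.Q × List (StackSymbol Unit)) × List Bool}
    (hr : x.foldlM C.readBit (s, w) = some r) :
    r.2 = w ++ (C.toCounter e).outFrom t x ∧ C.Simulates e r.1 ((C.toCounter e).final t x) ∧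
      r.1.2.length ≤ s.2.length + W * x.length := by
  induction x generalizing s t w with
  | nil =>
    simp only [List.foldlM_nil, Option.pure_def, Option.some.injEq] at hr
    subst hr
    exact ⟨by simp [CounterMachine.outFrom], h, by simp⟩
  | cons b x ih =>
    rw [List.foldlM_cons] at hr
    obtain ⟨⟨s₁, w₁⟩, h₁, hr⟩ := Option.bind_eq_some_iff.1 hr
    obtain ⟨v, hv⟩ := h.exists_top
    obtain ⟨q, st⟩ := s
    simp only at hv
    subst hv
    simp only [readBit, Option.map_eq_some_iff, Prod.mk.injEq] at h₁
    obtain ⟨s₂, hs₂, rfl, rfl⟩ := h₁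
    obtain ⟨t', ht', hsim⟩ := h.move_some hs₂
    have hread : (C.toCounter e).read t b = (C.toCounter e).close C.c t' := by
      unfold CounterMachine.read
      rw [ht']
    obtain ⟨i₁, i₂, i₃⟩ := ih (hsim.lambdaClose C.c) _ hr
    refine ⟨?_, ?_, ?_⟩
    · rw [i₁, CounterMachine.outFrom, hread, List.append_assoc]
      have h1 := h.1
      simp only at h1
      simp [toCounter, h1]
    · rw [CounterMachine.final, List.foldl_cons, hread]
      exact i₂
    · refine i₃.trans ?_
      have hl := C.length_lambdaClose_le C.c s₂
      simp only [pushdownStep, Option.map_eq_some_iff] at hs₂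
      obtain ⟨⟨q', u⟩, hδ, rfl⟩ := hs₂
      have := hW _ _ _ _ hδ
      simp only [List.length_append, List.length_cons] at hl this ⊢
      rw [mul_add]
      omega

end PushdownCompressor

/-- A lossless unary compressor computes the output of a counter machine that stays injective and
whose counter grows at most linearly. -/
theorem PushdownCompressor.IsLossless.exists_counterMachine {C : UPDC} (hC : C.IsLossless) :
    ∃ (M : CounterMachine) (s₀ : Fin M.N × ℕ) (W : ℕ),
      (∀ x, C.output x = M.outFrom s₀ x) ∧
      (∀ x, (M.final s₀ x).2 ≤ W * (x.length + 1)) ∧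
      ∀ x, Function.Injective fun y =>
        (M.outFrom (M.final s₀ x) y, (M.final (M.final s₀ x) y).1) := by
  have := C.finite
  obtain ⟨N, ⟨e⟩⟩ := Finite.exists_equiv_fin C.Q
  obtain ⟨W, hW⟩ := C.exists_push_bound
  let M := C.toCounter e
  let s₀ : Fin M.N × ℕ := (C.toCounter e).close C.c (e C.q₀, 0)
  have h₀ : C.Simulates e (C.q₀, [StackSymbol.bottom]) (e C.q₀, 0) := ⟨rfl, [], rfl⟩
  have h₁ := h₀.lambdaClose C.c
  have hrun : ∀ x, ∃ r, C.run x = some r ∧ r.2 = M.outFrom s₀ x ∧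
      C.Simulates e r.1 (M.final s₀ x) ∧
      r.1.2.length ≤ (C.lambdaClose C.c (C.q₀, [StackSymbol.bottom])).2.length + W * x.length := by
    intro x
    obtain ⟨r, hr⟩ := Option.isSome_iff_exists.1 (hC.1 x)
    exact ⟨r, hr, h₁.foldlM hW x [] hr⟩
  refine ⟨M, s₀, W + 1, fun x => ?_, fun x => ?_, fun x y y' h => ?_⟩
  · obtain ⟨r, hr, h2, -⟩ := hrun x
    simp [PushdownCompressor.output, hr, h2]
  · obtain ⟨r, -, -, ⟨-, u, hu⟩, h3⟩ := hrun x
    have h4 := C.length_lambdaClose_le C.c (C.q₀, [StackSymbol.bottom])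
    have h5 := congrArg List.length hu
    simp only [List.length_append, List.length_replicate, List.length_cons, List.length_nil]
      at h4 h5
    nlinarith
  · simp only [Prod.mk.injEq] at h
    -- Losslessness speaks of the initial configuration only; putting x in front transfers it to the
    -- configuration reached after x.
    apply List.append_cancel_left (as := x)
    apply hC.2
    obtain ⟨r, hr, h2, h3, -⟩ := hrun (x ++ y)
    obtain ⟨r', hr', h2', h3', -⟩ := hrun (x ++ y')
    have e1 : r.2 = r'.2 := by
      rw [h2, h2', CounterMachine.outFrom_append, CounterMachine.outFrom_append, h.1]
    have e2 : r.1.1 = r'.1.1 := by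
      apply e.injective
      rw [← h3.1, ← h3'.1, CounterMachine.final_append, CounterMachine.final_append, h.2]
    simp [hr, hr', e1, e2]

/-! ### Decoding from the output and the end states -/

namespace CounterMachine

open Classical in
/-- The string that is mapped to the output `y` and the final state `q'` from the configuration
`(q, h)`. -/
noncomputable def decode (M : CounterMachine) (q q' : Fin M.N) (h : ℕ) (y : List Bool) :
    List Bool :=
  if hx : ∃ x, M.outFrom (q, h) x = y ∧ (M.final (q, h) x).1 = q' then hx.choose else []

theorem decode_outFrom {M : CounterMachine} {s : Fin M.N × ℕ}
    (hs : Function.Injective fun y => (M.outFrom s y, (M.final s y).1)) (x : List Bool) :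
    M.decode s.1 (M.final s x).1 s.2 (M.outFrom s x) = x := by
  have hx : ∃ x', M.outFrom (s.1, s.2) x' = M.outFrom s x ∧
      (M.final (s.1, s.2) x').1 = (M.final s x).1 := ⟨x, rfl, rfl⟩
  rw [decode, dif_pos hx]
  exact hs (Prod.ext hx.choose_spec.1 hx.choose_spec.2)

end CounterMachine

/-! ### Finite-state transducers -/

namespace FST

instance : Countable FST := by
  let f : FST → Σ m : ℕ, Fin m × (Fin m → Bool → Fin m) × (Fin m → Bool → List Bool) :=
    fun T => ⟨T.m, T.init, T.step, T.out⟩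
  refine Function.Injective.countable (f := f) ?_
  rintro ⟨m, i, s, o⟩ ⟨m', i', s', o'⟩ h
  simp only [f, Sigma.mk.injEq] at h
  obtain ⟨rfl, h⟩ := h
  simp only [heq_eq_eq, Prod.mk.injEq] at h
  obtain ⟨rfl, rfl, rfl⟩ := h
  rfl

theorem exists_le_length_of_size_le {T : FST} {k : ℕ} (h : T.size ≤ k) :
    ∃ x, T.IsDescription x ∧ x.length ≤ k := by
  by_contra! hx
  have : ((k + 1 : ℕ) : ℕ∞) ≤ T.size :=
    le_iInf₂ fun x hd => by exact_mod_cast hx x hd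
  have h2 := this.trans h
  norm_cast at h2
  omega

theorem length_daggerCode : ∀ x : List Bool, (daggerCode x).length = 2 * x.length
  | [] => rfl
  | [b] => rfl
  | b :: c :: x => by
    rw [daggerCode, List.length_cons, List.length_cons, length_daggerCode (c :: x)]
    simp
    ring

theorem length_out_le_transitionCode (T : FST) (q : Fin T.m) (b : Bool) (n : ℕ) :
    (T.out q b).length + 1 ≤ (T.transitionCode q b n).length := by
  simp [transitionCode, diamondCode, length_daggerCode]
  omega

/-- A description contains a code for each transition, and that code is strictly longer than the
output of the transition. Both the number of states and the outputs are therefore bounded. -/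
theorem bounds_of_size_le {T : FST} {k : ℕ} (h : T.size ≤ k) :
    T.m ≤ k ∧ ∀ q b, (T.out q b).length ≤ k := by
  obtain ⟨x, ⟨y, ⟨n, -, rfl⟩, rfl⟩, hk⟩ := exists_le_length_of_size_le h
  simp only [List.length_append, List.length_flatMap] at hk
  have hl : ∀ q b, (T.out q b).length + 1 ≤
      (T.transitionCode q false (n q false)).length +
        (T.transitionCode q true (n q true)).length := by
    intro q b
    have h1 := T.length_out_le_transitionCode q b (n q b)
    cases b <;> omega
  rw [← List.ofFn_eq_map, List.sum_ofFn] at hk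
  refine ⟨?_, fun q b => ?_⟩
  · have : ∑ _q : Fin T.m, 1 ≤ ∑ q : Fin T.m, ((T.transitionCode q false (n q false)).length +
        (T.transitionCode q true (n q true)).length) :=
      Finset.sum_le_sum fun q _ => by have := hl q false; omega
    simp only [Finset.sum_const, Finset.card_univ, Fintype.card_fin, smul_eq_mul, mul_one] at this
    omega
  · have h1 := Finset.single_le_sum (f := fun q : Fin T.m =>
      (T.transitionCode q false (n q false)).length +
        (T.transitionCode q true (n q true)).length) (fun _ _ => Nat.zero_le _)
      (Finset.mem_univ q)
    have := hl q b
    omega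

theorem finite_size_le (k : ℕ) : {T : FST | T.size ≤ k}.Finite := by
  have := (List.finite_length_le Bool k).to_subtype
  let f : (Σ m : Fin (k + 1), Fin m × (Fin m → Bool → Fin m) ×
      (Fin m → Bool → {l : List Bool | l.length ≤ k})) → FST :=
    fun z => ⟨z.1, z.2.1, z.2.2.1, fun q b => z.2.2.2 q b⟩
  refine (Set.finite_range f).subset fun T hT => ?_
  obtain ⟨hm, ho⟩ := bounds_of_size_le hT
  exact ⟨⟨⟨T.m, Nat.lt_succ_of_le hm⟩, T.init, T.step, fun q b => ⟨T.out q b, ho q b⟩⟩, rfl⟩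

/-- The identity transducer. -/
def identity : FST where
  m := 1
  init := 0
  step _ _ := 0
  out _ b := [b]

theorem identity_run (x : List Bool) : identity.run x = x := by
  have : ∀ q, identity.runFrom q x = x := by
    induction x with
    | nil => intro q; rfl
    | cons b x ih =>
      intro q
      rw [runFrom, ih]
      rfl
  exact this _

theorem exists_identity_size_le : ∃ k : ℕ, identity.size ≤ k := by
  have h : identity.IsTableCode ((List.finRange 1).flatMap fun q =>
      identity.transitionCode q false 1 ++ identity.transitionCode q true 1) :=
    ⟨fun _ _ => 1, fun q b => ⟨le_rfl, by simp [identity]⟩, rfl⟩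
  exact ⟨_, iInf₂_le _ ⟨_, h, rfl⟩⟩

/-! ### Input lengths needed by a transducer -/

/-- The input bit whose output straddles the cut is needed on both sides; this is the extra 1. -/
theorem exists_split_of_runFrom_eq_append (T : FST) (q : Fin T.m) (y p r : List Bool)
    (h : T.runFrom q y = p ++ r) : ∃ y₁ q₂ y₂, p <+: T.runFrom q y₁ ∧ r <:+ T.runFrom q₂ y₂ ∧
      y₁.length + y₂.length ≤ y.length + 1 := by
  induction y generalizing q p with
  | nil =>
    simp only [runFrom] at h
    obtain ⟨rfl, rfl⟩ := List.append_eq_nil_iff.1 h.symm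
    exact ⟨[], q, [], by simp, by simp, by simp⟩
  | cons b y ih =>
    have h' := h
    rw [runFrom] at h
    rcases List.append_eq_append_iff.1 h with ⟨p', rfl, hr⟩ | ⟨p', hp, -⟩
    · obtain ⟨y₁, q₂, y₂, h₁, h₂, h₃⟩ := ih _ p' hr
      refine ⟨b :: y₁, q₂, y₂, ?_, h₂, by simp only [List.length_cons]; omega⟩
      rw [runFrom]
      exact (List.prefix_append_right_inj _).2 h₁
    · refine ⟨[b], q, b :: y, ?_, ?_, by simp only [List.length_cons, List.length_nil]; omega⟩
      · rw [runFrom, runFrom, List.append_nil, hp]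
        exact List.prefix_append _ _
      · rw [h']
        exact List.suffix_append _ _

/-- Every input on which `T` produces `x` within its output has length at least `c`. -/
def Needs (T : FST) (x : List Bool) (c : ℕ) : Prop :=
  ∀ q y, x <:+: T.runFrom q y → c ≤ y.length

theorem Needs.mono {T : FST} {x x' : List Bool} {c c' : ℕ} (h : T.Needs x c) (hx : x <:+: x')
    (hc : c' ≤ c) : T.Needs x' c' := fun q y hy => hc.trans (h q y (hx.trans hy))

/-- Since `Needs` ranges over all starting states and over factors of the output, it applies to each
part of a split input; only the shared bit is lost. -/
theorem Needs.append {T : FST} {x₁ x₂ : List Bool} {c₁ c₂ c : ℕ} (h₁ : T.Needs x₁ c₁)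
    (h₂ : T.Needs x₂ c₂) (hc : c + 1 ≤ c₁ + c₂) : T.Needs (x₁ ++ x₂) c := by
  rintro q y ⟨u, v, h⟩
  obtain ⟨y₁, q₂, y₂, hp, hr, hl⟩ := T.exists_split_of_runFrom_eq_append q y (u ++ x₁) (x₂ ++ v)
    (by rw [← h]; simp)
  have := h₁ q y₁ ((List.suffix_append u x₁).isInfix.trans hp.isInfix)
  have := h₂ q₂ y₂ ((List.prefix_append x₂ v).isInfix.trans hr.isInfix)
  omega

theorem Needs.zero (T : FST) (x : List Bool) : T.Needs x 0 := fun _ _ _ => Nat.zero_le _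

theorem exists_length_runFrom_le (T : FST) :
    ∃ M, ∀ q y, (T.runFrom q y).length ≤ M * y.length := by
  obtain ⟨M, hM⟩ := (Set.finite_range fun z : Fin T.m × Bool => (T.out z.1 z.2).length).bddAbove
  refine ⟨M, fun q y => ?_⟩
  induction y generalizing q with
  | nil => simp [runFrom]
  | cons b y ih =>
    have h1 := ih (T.step q b)
    have h2 : (T.out q b).length ≤ M := hM ⟨(q, b), rfl⟩
    simp only [runFrom, List.length_append, List.length_cons]
    rw [mul_add]
    omega

/-- The factor of length `n` at position `a` of the output on `y` from state `q`. -/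
def factor (T : FST) (q : Fin T.m) (n a : ℕ) (y : List Bool) : List Bool :=
  ((T.runFrom q y).drop a).take n

/-- An input shorter than c has an output of length at most M * c, so the position of x in it is one
of M * c + 1 values and can serve as advice. -/
theorem needs_of_factor {T : FST} {x : List Bool} {c M : ℕ}
    (hM : ∀ q y, (T.runFrom q y).length ≤ M * y.length)
    (h : ∀ q, ∀ a < M * c + 1, ∀ y, T.factor q x.length a y = x → c ≤ y.length) :
    T.Needs x c := by
  rintro q y ⟨u, v, huv⟩
  by_contra! hlt
  have hu : u.length ≤ M * c := by
    have h1 := hM q y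
    rw [← huv] at h1
    have h2 : M * y.length ≤ M * c := Nat.mul_le_mul_left _ hlt.le
    simp only [List.length_append] at h1
    omega
  have := h q u.length (by omega) y (by simp [factor, ← huv])
  omega

end FST

/-! ### A pushdown compressor for palindromic blocks -/

/-- The states of the compressor of palindromes with flag `1^k`: copying the input after `i`
pending ones, comparing the input with the stack when `w` has been matched since the last output,
or copying the input after a mismatch. -/
inductive PalState (k v : ℕ) where
  | lit (i : Fin k)
  | pop (w : {w : List Bool // w.length < v})
  | err

namespace PalState

variable {k v : ℕ}

instance : Finite (PalState k v) := by
  have : Finite {w : List Bool // w.length < v} := (List.finite_length_lt Bool v).to_subtype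
  let f : Fin k ⊕ {w : List Bool // w.length < v} ⊕ Unit → PalState k v
    | .inl i => .lit i
    | .inr (.inl w) => .pop w
    | .inr (.inr _) => .err
  refine Finite.of_surjective f ?_
  rintro (i | w | _)
  exacts [⟨.inl i, rfl⟩, ⟨.inr (.inl w), rfl⟩, ⟨.inr (.inr ()), rfl⟩]

variable [NeZero k] [NeZero v]

/-- The comparing state with empty buffer. -/
def popEmpty : PalState k v := .pop ⟨[], Nat.pos_of_neZero v⟩

/-- The state and the pushed string after copying `b` with `i` ones pending. -/
def litNext (i : Fin k) (b : Bool) : PalState k v × List Bool :=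
  if b then (if h : i + 1 < k then .lit ⟨i + 1, h⟩ else popEmpty, [])
  else (.lit 0, false :: List.replicate i true)

/-- The state and the output after a match. -/
def popNext (w : {w : List Bool // w.length < v}) (b : Bool) : PalState k v × List Bool :=
  if h : w.1.length + 1 < v then (.pop ⟨w.1 ++ [b], by simpa using h⟩, []) else (popEmpty, [false])

/-- One step on a configuration (state, stack without the bottom symbol), with its output. -/
def step : PalState k v × List Bool → Bool → (PalState k v × List Bool) × List Bool
  | (.lit i, l), b => (((litNext i b).1, (litNext (v := v) i b).2 ++ l), [b])
  | (.pop _, []), b => (litNext 0 b, [false, b])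
  | (.pop w, a :: l), b =>
    if a = b then (((popNext w b).1, l), (popNext (k := k) w b).2)
    else ((.err, l), true :: (w.1 ++ [b]))
  | (.err, l), b => ((.err, l), [b])

/-- The output on a string. -/
def out : PalState k v × List Bool → List Bool → List Bool
  | _, [] => []
  | s, b :: x => (step s b).2 ++ out (step s b).1 x

/-- The configuration reached on a string. -/
def final (s : PalState k v × List Bool) (x : List Bool) : PalState k v × List Bool :=
  x.foldl (fun s b => (step s b).1) s

theorem final_append (s : PalState k v × List Bool) (x y : List Bool) :
    final s (x ++ y) = final (final s x) y := List.foldl_append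

theorem out_append (s : PalState k v × List Bool) (x y : List Bool) :
    out s (x ++ y) = out s x ++ out (final s x) y := by
  induction x generalizing s with
  | nil => rfl
  | cons b x ih => simp [out, ih, final]

theorem out_err (l x : List Bool) : out ((.err, l) : PalState k v × List Bool) x = x := by
  induction x with
  | nil => rfl
  | cons b x ih => simp [out, step, ih]

/-- While comparing, the first output bit tells what happened. Silence leaves the input in the
buffer, 0 reports a full buffer or an empty stack, and 1 is followed by the buffer and the rest of
the input verbatim. -/
theorem out_pop_cases (w : {w : List Bool // w.length < v}) (l x : List Bool) :
    (out ((.pop w, l) : PalState k v × List Bool) x = [] ∧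
      ∃ h, (final ((.pop w, l) : PalState k v × List Bool) x).1 = .pop ⟨w.1 ++ x, h⟩) ∨
    (∃ t, out ((.pop w, l) : PalState k v × List Bool) x = false :: t) ∨
    out ((.pop w, l) : PalState k v × List Bool) x = true :: (w.1 ++ x) := by
  induction x generalizing w l with
  | nil => exact Or.inl ⟨rfl, by simpa using w.2, by simp [final]⟩
  | cons b x ih =>
    cases l with
    | nil => exact Or.inr (Or.inl ⟨_, by simp only [out, step, List.cons_append]; rfl⟩)
    | cons a l =>
      by_cases hab : a = b
      · by_cases hw : w.1.length + 1 < v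
        · have hs : step ((.pop w, a :: l) : PalState k v × List Bool) b =
              ((.pop ⟨w.1 ++ [b], by simpa using hw⟩, l), []) := by
            simp [step, hab, popNext, hw]
          simp only [out, final, List.foldl_cons, hs, List.nil_append]
          simpa [final] using ih ⟨w.1 ++ [b], by simpa using hw⟩ l
        · have hs : step ((.pop w, a :: l) : PalState k v × List Bool) b =
              ((popEmpty, l), [false]) := by
            simp [step, hab, popNext, hw]
          simp only [out, hs]
          exact Or.inr (Or.inl ⟨_, rfl⟩)
      · have hs : step ((.pop w, a :: l) : PalState k v × List Bool) b =
            ((.err, l), true :: (w.1 ++ [b])) := by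
          simp [step, hab]
        refine Or.inr (Or.inr ?_)
        simp [out, hs, out_err]

/-- It suffices to recover the first input bit and to induct, or to recover the whole input at once.
The decoder knows the configuration, including the stack. -/
theorem out_injective (s : PalState k v × List Bool) (x y : List Bool) (h : out s x = out s y)
    (hf : (final s x).1 = (final s y).1) : x = y := by
  induction x generalizing s y with
  | nil =>
    cases y with
    | nil => rfl
    | cons c y =>
      obtain ⟨i | w | _, l⟩ := s
      · simp [out, step] at h
      · rcases out_pop_cases (k := k) w l (c :: y) with ⟨-, hw, h2⟩ | ⟨t, h2⟩ | h2
        · rw [h2] at hf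
          simp [final] at hf
          exact absurd (congrArg (fun z => z.1.length) hf) (by simp)
        · rw [h2] at h
          simp [out] at h
        · rw [h2] at h
          simp [out] at h
      · simp [out, step] at h
  | cons b x ih =>
    cases y with
    | nil =>
      obtain ⟨i | w | _, l⟩ := s
      · simp [out, step] at h
      · rcases out_pop_cases (k := k) w l (b :: x) with ⟨-, hw, h2⟩ | ⟨t, h2⟩ | h2
        · rw [h2] at hf
          simp [final] at hf
          exact absurd (congrArg (fun z => z.1.length) hf) (by simp)
        · rw [h2] at h
          simp [out] at h
        · rw [h2] at h
          simp [out] at h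
      · simp [out, step] at h
    | cons c y =>
      have key : b = c → b :: x = c :: y := by
        rintro rfl
        rw [out, out] at h
        rw [ih _ _ (List.append_cancel_left h) hf]
      obtain ⟨i | w | _, l⟩ := s
      · exact key (by simpa [out, step] using (List.cons.inj h).1)
      · rcases out_pop_cases (k := k) w l (b :: x) with ⟨h1, hw, h2⟩ | ⟨t, h1⟩ | h1 <;>
        rcases out_pop_cases (k := k) w l (c :: y) with ⟨h1', hw', h2'⟩ | ⟨t', h1'⟩ | h1' <;>
        rw [h1, h1'] at h
        · rw [h2, h2'] at hf
          simpa using hf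
        · simp at h
        · simp at h
        · simp at h
        · cases l with
          | nil =>
            simp only [out, step, List.cons_append, List.nil_append, List.cons.injEq,
              true_and] at h1 h1' h
            exact key (List.head_eq_of_cons_eq (h1.trans (h.trans h1'.symm)))
          | cons a l =>
            -- A mismatch would write 1 at once, so an output beginning with 0 forces the first bit
            -- to equal the stack top.
            have hm : ∀ d z u, out ((.pop w, a :: l) : PalState k v × List Bool) (d :: z) =
                false :: u → a = d := by
              intro d z u hd
              by_contra hne
              simp [out, step, hne] at hd
            exact key ((hm _ _ _ h1).symm.trans (hm _ _ _ h1'))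
        · simp at h
        · simp at h
        · simp at h
        · simpa using h
      · exact key (by simpa [out, step] using (List.cons.inj h).1)

/-! ### Its output on palindromic blocks -/

/-- Ones are withheld from the stack until a 0 shows that they are not part of a flag. As the string
ends in 0 and contains no flag, all of it gets pushed. -/
theorem lit_of_no_run (x : List Bool) (i : Fin k) (l : List Bool)
    (h : ¬ List.replicate k true <:+: List.replicate i true ++ (x ++ [false])) :
    out ((.lit i, l) : PalState k v × List Bool) (x ++ [false]) = x ++ [false] ∧
    final ((.lit i, l) : PalState k v × List Bool) (x ++ [false]) =
      (.lit 0, (List.replicate i true ++ (x ++ [false])).reverse ++ l) := by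
  induction x generalizing i l with
  | nil => simp [out, final, step, litNext]
  | cons b x ih =>
    cases b with
    | false =>
      obtain ⟨h1, h2⟩ := ih 0 (false :: List.replicate i true ++ l) (by
        intro hx
        simp only [Fin.val_zero, List.replicate_zero, List.nil_append] at hx
        refine h (hx.trans ⟨List.replicate i true ++ [false], [], by simp⟩))
      simp only [List.cons_append] at h1 h2 ⊢
      simp only [out, final, List.foldl_cons, step, litNext] at h1 h2 ⊢
      exact ⟨by simpa using h1, by simpa using h2⟩
    | true =>
      have hi : (i : ℕ) + 1 < k := by
        by_contra hk
        have hik : k = i + 1 := by have := i.2; omega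
        refine h ⟨[], x ++ [false], ?_⟩
        rw [List.nil_append]
        conv_lhs => rw [hik]
        simp [List.replicate_succ']
      obtain ⟨h1, h2⟩ := ih ⟨i + 1, hi⟩ l (by
        intro hx
        refine h ?_
        simpa [List.replicate_succ'] using hx)
      simp only [List.cons_append] at h1 h2 ⊢
      simp only [out, final, List.foldl_cons, step, litNext, hi, if_true, dif_pos] at h1 h2 ⊢
      refine ⟨by simpa using h1, ?_⟩
      simpa [List.replicate_succ'] using h2

theorem lit_flag (n : ℕ) (i : Fin k) (hi : i + (n + 1) = k) (l : List Bool) :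
    (out ((.lit i, l) : PalState k v × List Bool) (List.replicate (n + 1) true)).length = n + 1 ∧
    final ((.lit i, l) : PalState k v × List Bool) (List.replicate (n + 1) true) =
      (popEmpty, l) := by
  induction n generalizing i with
  | zero =>
    have : ¬ (i : ℕ) + 1 < k := by omega
    simp [out, final, step, litNext, this]
  | succ n ih =>
    have h : (i : ℕ) + 1 < k := by omega
    obtain ⟨h1, h2⟩ := ih ⟨i + 1, h⟩ (by simp only; omega)
    rw [List.replicate_succ]
    simp only [out, final, List.foldl_cons, step, litNext, h, if_true, dif_pos] at h1 h2 ⊢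
    exact ⟨by simpa using h1, by simpa using h2⟩

/-- The buffer length acts as a potential: each output bit consumes v matches, some of which may
precede x. -/
theorem pop_matching (x l : List Bool) (w : {w : List Bool // w.length < v}) :
    ∃ w' : {w : List Bool // w.length < v},
      final ((.pop w, x ++ l) : PalState k v × List Bool) x = (.pop w', l) ∧
      v * (out ((.pop w, x ++ l) : PalState k v × List Bool) x).length ≤ w.1.length + x.length := by
  induction x generalizing w with
  | nil => exact ⟨w, rfl, by simp [out]⟩
  | cons b x ih =>
    by_cases hw : w.1.length + 1 < v
    · obtain ⟨w', h1, h2⟩ := ih ⟨w.1 ++ [b], by simpa using hw⟩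
      refine ⟨w', ?_, ?_⟩
      · simpa [final, step, popNext, hw] using h1
      · simp [out, step, popNext, hw] at h2 ⊢
        omega
    · obtain ⟨w', h1, h2⟩ := ih ⟨[], Nat.pos_of_neZero v⟩
      refine ⟨w', ?_, ?_⟩
      · simpa [final, step, popNext, hw, popEmpty] using h1
      · have := w.2
        simp [out, step, popNext, hw, popEmpty, mul_add] at h2 ⊢
        omega

/-- A leftover buffer may be dropped because its bits were matched against a known stack. Starting
the next block costs one extra bit, the + 1 in `IsRest.flagBlock`. -/
theorem pop_empty_stack (w : {w : List Bool // w.length < v}) {x : List Bool} (hx : x ≠ []) :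
    out ((.pop w, []) : PalState k v × List Bool) x =
      false :: out ((.lit 0, []) : PalState k v × List Bool) x ∧
    final ((.pop w, []) : PalState k v × List Bool) x =
      final ((.lit 0, []) : PalState k v × List Bool) x := by
  cases x with
  | nil => exact absurd rfl hx
  | cons b x => simp [out, final, step]

/-- The configurations between two palindromic blocks. -/
def IsRest (s : PalState k v × List Bool) : Prop := s.2 = [] ∧ (s.1 = .lit 0 ∨ ∃ w, s.1 = .pop w)

theorem IsRest.flagBlock {s : PalState k v × List Bool} (hs : IsRest s) {R : List Bool}
    (hR : ¬ List.replicate k true <:+: R) (hend : ∃ y, R = y ++ [false]) :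
    IsRest (final s (flagBlock k R)) ∧
      (out s (flagBlock k R)).length ≤ R.length + k + 1 + R.length / v := by
  have h₀ : IsRest (final ((.lit 0, []) : PalState k v × List Bool) (_root_.flagBlock k R)) ∧
      (out ((.lit 0, []) : PalState k v × List Bool) (_root_.flagBlock k R)).length ≤
        R.length + k + R.length / v := by
    obtain ⟨y, hy⟩ := hend
    obtain ⟨h1, h2⟩ := lit_of_no_run (v := v) y (0 : Fin k) [] (by simpa [← hy] using hR)
    rw [← hy] at h1 h2
    simp only [Fin.val_zero, List.replicate_zero, List.nil_append, List.append_nil] at h2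
    obtain ⟨n, hn⟩ : ∃ n, k = n + 1 := ⟨k - 1, by have := Nat.pos_of_neZero k; omega⟩
    obtain ⟨h3, h4⟩ := lit_flag (v := v) n (0 : Fin k) (by simp [hn]) R.reverse
    rw [← hn] at h3 h4
    obtain ⟨w', h5, h6⟩ := pop_matching (k := k) R.reverse []
      (⟨[], Nat.pos_of_neZero v⟩ : {w : List Bool // w.length < v})
    rw [List.append_nil] at h5 h6
    rw [_root_.flagBlock]
    simp only [final_append, out_append, h2, h4, h1, popEmpty]
    refine ⟨?_, ?_⟩
    · rw [h5]
      exact ⟨rfl, Or.inr ⟨w', rfl⟩⟩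
    · simp only [List.length_append, h3]
      simp only [List.length_nil, List.length_reverse, zero_add] at h6
      have h7 := (Nat.le_div_iff_mul_le (Nat.pos_of_neZero v)).2 ((mul_comm _ _).trans_le h6)
      omega
  have hne : _root_.flagBlock k R ≠ [] := by
    obtain ⟨y, rfl⟩ := hend
    simp [_root_.flagBlock]
  obtain ⟨q, l⟩ := s
  obtain ⟨rfl, rfl | ⟨w, rfl⟩⟩ : l = [] ∧ (q = .lit 0 ∨ ∃ w, q = .pop w) := hs
  · exact ⟨h₀.1, by omega⟩
  · obtain ⟨h1, h2⟩ := pop_empty_stack (k := k) w hne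
    rw [h1, h2]
    refine ⟨h₀.1, ?_⟩
    simp only [List.length_cons]
    omega

end PalState

/-! ### The compressor as a pushdown machine -/

open PalState in
/-- The compressor of palindromes with flag `1^k` and buffer bound `v`. -/
abbrev palCompressor (k v : ℕ) [NeZero k] [NeZero v] : PDC where
  Q := PalState k v
  finite := inferInstance
  δ q b a :=
    match q, b, a with
    | _, none, _ => none
    | .lit i, some b, a => some ((litNext i b).1, (litNext (v := v) i b).2.map .sym ++ [a])
    | .pop _, some b, .bottom =>
      some ((litNext 0 b).1, (litNext (k := k) (v := v) 0 b).2.map .sym ++ [.bottom])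
    | .pop w, some b, .sym a => some (if a = b then (popNext w b).1 else .err, [])
    | .err, some _, a => some (.err, [a])
  ν q b a :=
    match q, b, a with
    | _, none, _ => []
    | .lit _, some b, _ => [b]
    | .pop _, some b, .bottom => [false, b]
    | .pop w, some b, .sym a => if a = b then (popNext (k := k) w b).2 else true :: (w.1 ++ [b])
    | .err, some b, _ => [b]
  q₀ := .lit 0
  c := 0
  bottom_kept := by
    rintro (i | w | _) (_ | b) q' u h
    all_goals simp at h
    · exact ⟨_, h.2.symm⟩
    · exact ⟨_, h.2.symm⟩
    · exact ⟨[], h.2.symm⟩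
  lambda_pops := by
    rintro (i | w | _) a q' u h <;> simp at h
  deterministic := by
    rintro (i | w | _) a <;> simp
  lambda_bound := by
    rintro ⟨i | w | _, _ | ⟨a, u⟩⟩ <;> simp [pushdownStep]
  lambda_silent := by
    rintro (i | w | _) a <;> rfl

section

variable {k v : ℕ} [NeZero k] [NeZero v]

theorem palCompressor_readBit (s : PalState k v × List Bool) (w : List Bool) (b : Bool) :
    (palCompressor k v).readBit ((s.1, s.2.map StackSymbol.sym ++ [StackSymbol.bottom]), w) b =
      some (((PalState.step s b).1.1,
        (PalState.step s b).1.2.map StackSymbol.sym ++ [StackSymbol.bottom]),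
        w ++ (PalState.step s b).2) := by
  obtain ⟨i | u | _, _ | ⟨a, l⟩⟩ := s
  all_goals
    try by_cases hab : a = b
    all_goals
      simp [PushdownCompressor.readBit, pushdownStep, palCompressor, PalState.step,
        PushdownCompressor.lambdaClose, *]

theorem palCompressor_run (x : List Bool) :
    (palCompressor k v).run x =
      some (((PalState.final (.lit 0, []) x).1,
        (PalState.final ((.lit 0, []) : PalState k v × List Bool) x).2.map StackSymbol.sym ++
          [StackSymbol.bottom]), PalState.out ((.lit 0, []) : PalState k v × List Bool) x) := by
  have key : ∀ (s : PalState k v × List Bool) (w : List Bool),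
      x.foldlM (palCompressor k v).readBit
        ((s.1, s.2.map StackSymbol.sym ++ [StackSymbol.bottom]), w) =
      some (((PalState.final s x).1, (PalState.final s x).2.map StackSymbol.sym ++
          [StackSymbol.bottom]), w ++ PalState.out s x) := by
    induction x with
    | nil => intro s w; simp [PalState.final, PalState.out]
    | cons b x ih =>
      intro s w
      rw [List.foldlM_cons, palCompressor_readBit]
      refine (ih (PalState.step s b).1 _).trans ?_
      simp [PalState.final, PalState.out]
  exact key (.lit 0, []) []

theorem palCompressor_output (x : List Bool) :
    (palCompressor k v).output x = PalState.out ((.lit 0, []) : PalState k v × List Bool) x := by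
  rw [PushdownCompressor.output, palCompressor_run]
  rfl

theorem palCompressor_isLossless : (palCompressor k v).IsLossless := by
  refine ⟨fun x => by rw [palCompressor_run]; rfl, fun x y h => ?_⟩
  simp only [palCompressor_run, Option.map_some, Option.some.injEq, Prod.mk.injEq] at h
  exact PalState.out_injective _ _ _ h.1 h.2

end

/-! ### Infinite concatenations -/

/-- The concatenation of the first `J` blocks. -/
def blockPrefix (B : ℕ → List Bool) (J : ℕ) : List Bool := (List.range J).flatMap B

theorem blockPrefix_succ (B : ℕ → List Bool) (J : ℕ) :
    blockPrefix B (J + 1) = blockPrefix B J ++ B J := by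
  simp [blockPrefix, List.range_succ]

theorem blockPrefix_prefix (B : ℕ → List Bool) {J J' : ℕ} (h : J ≤ J') :
    blockPrefix B J <+: blockPrefix B J' := by
  induction J', h using Nat.le_induction with
  | base => exact List.prefix_rfl
  | succ n _ ih => exact ih.trans (blockPrefix_succ B n ▸ List.prefix_append _ _)

theorem le_length_blockPrefix {B : ℕ → List Bool} (hB : ∀ j, B j ≠ []) (J : ℕ) :
    J ≤ (blockPrefix B J).length := by
  induction J with
  | zero => exact Nat.zero_le _
  | succ J ih =>
    have := List.length_pos_iff.2 (hB J)
    rw [blockPrefix_succ, List.length_append]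
    omega

theorem exists_isConcatenation {B : ℕ → List Bool} (hB : ∀ j, B j ≠ []) :
    ∃ S, IsConcatenation S B := by
  -- The default is never used: n + 1 nonempty blocks have total length greater than n.
  refine ⟨fun n => (blockPrefix B (n + 1)).getD n false,
    tendsto_atTop_mono (le_length_blockPrefix hB) tendsto_id, fun J => ?_⟩
  change seqPrefix _ (blockPrefix B J).length = blockPrefix B J
  refine List.ext_getElem (by simp [seqPrefix]) fun i h₁ h₂ => ?_
  have hi : i < (blockPrefix B (i + 1)).length := le_length_blockPrefix hB (i + 1)
  simp only [seqPrefix, List.getElem_map, List.getElem_range]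
  rw [List.getD_eq_getElem _ _ hi]
  rcases le_total (i + 1) J with h | h
  · exact (blockPrefix_prefix B h).getElem hi
  · exact ((blockPrefix_prefix B h).getElem h₂).symm

theorem seqPrefix_prefix (S : ℕ → Bool) {m n : ℕ} (h : m ≤ n) :
    seqPrefix S m <+: seqPrefix S n := by
  obtain ⟨d, rfl⟩ := Nat.exists_eq_add_of_le h
  rw [seqPrefix, seqPrefix, List.range_add, List.map_append]
  exact List.prefix_append _ _

theorem length_seqPrefix (S : ℕ → Bool) (n : ℕ) : (seqPrefix S n).length = n := by
  simp [seqPrefix]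

/-- Every long prefix lies between two consecutive concatenations of blocks. -/
theorem IsConcatenation.eventually_between {S : ℕ → Bool} {B : ℕ → List Bool}
    (hS : IsConcatenation S B) (J₀ : ℕ) : ∀ᶠ n in atTop, ∃ J ≥ J₀,
      (blockPrefix B J).length ≤ n ∧ n ≤ (blockPrefix B (J + 1)).length ∧
      blockPrefix B J <+: seqPrefix S n ∧ seqPrefix S n <+: blockPrefix B (J + 1) := by
  filter_upwards [eventually_ge_atTop (blockPrefix B J₀).length] with n hn
  have hex : ∃ J, n < (blockPrefix B J).length := (hS.1.eventually_gt_atTop n).exists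
  classical
  have h₁ : n < (blockPrefix B (Nat.find hex)).length := Nat.find_spec hex
  have h₀ : J₀ < Nat.find hex := by
    by_contra! h
    have := (blockPrefix_prefix B h).length_le
    omega
  obtain ⟨J, hJ⟩ : ∃ J, Nat.find hex = J + 1 := ⟨Nat.find hex - 1, by omega⟩
  have h₂ : (blockPrefix B J).length ≤ n := not_lt.1 (Nat.find_min hex (by omega))
  rw [hJ] at h₁
  refine ⟨J, by omega, h₂, h₁.le, ?_, ?_⟩
  · have := seqPrefix_prefix S h₂
    rwa [show seqPrefix S (blockPrefix B J).length = blockPrefix B J from hS.2 J] at this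
  · have := seqPrefix_prefix S h₁.le
    rwa [show seqPrefix S (blockPrefix B (J + 1)).length = blockPrefix B (J + 1)
      from hS.2 (J + 1)] at this

/-! ### Lengths -/

section Lengths

variable {L : ℕ} {R : ℕ → List Bool}

theorem length_flagBlock (k : ℕ) (x : List Bool) :
    (flagBlock k x).length = 2 * x.length + k := by
  simp [flagBlock]
  ring

theorem length_blockPrefix_flagBlock (hR : ∀ j, (R j).length = blockLength L j) (J : ℕ) :
    ((blockPrefix (fun j => flagBlock (2 * L) (R j)) J).length : ℝ) =
      4 * L * (J ^ 2 + 3 * J) + (2 * L + 2) * J := by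
  induction J with
  | zero => simp [blockPrefix]
  | succ J ih =>
    rw [blockPrefix_succ, List.length_append, length_flagBlock, hR, blockLength]
    push_cast
    rw [ih]
    ring

theorem length_blockPrefix_le (hR : ∀ j, (R j).length = blockLength L j) (J : ℕ) :
    (blockPrefix (fun j => flagBlock (2 * L) (R j)) (J + 1)).length + 1 ≤
      (18 * L + 3) * (J + 1) ^ 2 := by
  have h := length_blockPrefix_flagBlock hR (J + 1)
  have : ((blockPrefix (fun j => flagBlock (2 * L) (R j)) (J + 1)).length : ℝ) + 1 ≤
      (18 * L + 3) * (J + 1) ^ 2 := by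
    rw [h]
    push_cast
    have hJ : (0 : ℝ) ≤ J := Nat.cast_nonneg J
    have hL : (0 : ℝ) ≤ L := Nat.cast_nonneg L
    nlinarith [mul_nonneg hL hJ, mul_nonneg hL (mul_nonneg hJ hJ), mul_nonneg hJ hJ]
  exact_mod_cast this

/-- The - 2 pays for the two cuts per block in the transducer bound; the compressor bound does not
need it but shares the estimate. -/
theorem sum_codeLength (hL : 1 ≤ L) (j₀ : ℕ) {J : ℕ} (hJ : j₀ ≤ J) :
    ((∑ j ∈ Finset.Ico j₀ J, (2 * codeLength L j - 2) : ℕ) : ℝ) =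
      (4 * L - 2) * (J ^ 2 + 3 * J - (j₀ ^ 2 + 3 * j₀)) := by
  induction J, hJ using Nat.le_induction with
  | base => simp
  | succ J hJ ih =>
    rw [Finset.sum_Ico_succ_top hJ, Nat.cast_add, ih]
    have : 2 * codeLength L J - 2 = 2 * ((4 * L - 2) * (J + 2)) := by
      rw [codeLength]
      omega
    rw [this]
    push_cast [Nat.cast_sub (show 2 ≤ 4 * L by omega)]
    ring

theorem eventually_le_sum_codeLength {S : ℕ → Bool} (hL : 1 ≤ L)
    (hR : ∀ j, (R j).length = blockLength L j)
    (hS : IsConcatenation S fun j => flagBlock (2 * L) (R j)) (j₀ : ℕ) :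
    ∀ᶠ n : ℕ in atTop, ∃ J ≥ j₀,
      blockPrefix (fun j => flagBlock (2 * L) (R j)) J <+: seqPrefix S n ∧
      (1 - 1 / (L : ℝ)) * n ≤
        ((∑ j ∈ Finset.Ico j₀ J, (2 * codeLength L j - 2) : ℕ) : ℝ) := by
  -- The leading coefficients are 4L - 2 against (1 - 1/L) * 4L = 4L - 4. The surplus 2J² absorbs
  -- the lower-order terms, through 28L, and the blocks before j₀, through the last summand.
  filter_upwards [hS.eventually_between (j₀ + 28 * L + 4 * L * (j₀ ^ 2 + 3 * j₀))]
    with n h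
  obtain ⟨J, hJ, -, hn, hp, -⟩ := h
  refine ⟨J, by omega, hp, ?_⟩
  rw [sum_codeLength hL j₀ (by omega)]
  have hn' : (n : ℝ) ≤ _ := (Nat.cast_le.2 hn).trans_eq (length_blockPrefix_flagBlock hR (J + 1))
  have hL' : (1 : ℝ) ≤ L := by exact_mod_cast hL
  have hJ' : (j₀ : ℝ) + 28 * L + 4 * L * (j₀ ^ 2 + 3 * j₀) ≤ J := by exact_mod_cast hJ
  have hj₀ : (0 : ℝ) ≤ j₀ := Nat.cast_nonneg j₀
  have hc : (0 : ℝ) ≤ 1 - 1 / (L : ℝ) := by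
    rw [sub_nonneg, div_le_one (by linarith)]
    exact hL'
  refine (mul_le_mul_of_nonneg_left hn' hc).trans ?_
  push_cast
  have e : (1 - 1 / (L : ℝ)) * (4 * L * ((J + 1) ^ 2 + 3 * (J + 1)) + (2 * L + 2) * (J + 1)) =
      4 * (L - 1) * ((J + 1) ^ 2 + 3 * (J + 1)) + (2 * L - 2 / L) * (J + 1) := by
    field_simp
    ring
  rw [e]
  have h2 : (0 : ℝ) ≤ 2 / L := by positivity
  have hc0 : (0 : ℝ) ≤ (j₀ : ℝ) ^ 2 + 3 * j₀ := by positivity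
  generalize (j₀ : ℝ) ^ 2 + 3 * j₀ = c at *
  have hLc : 0 ≤ (L : ℝ) * c := by positivity
  have hJ1 : (1 : ℝ) ≤ J := by nlinarith
  have h3 : 0 ≤ (J : ℝ) * (J - (28 * L + 4 * L * c)) := mul_nonneg (by linarith) (by linarith)
  have h4 : 0 ≤ (L : ℝ) * (J - 1) := mul_nonneg (by linarith) (by linarith)
  have h5 : 0 ≤ (L : ℝ) * c * (J - 1) := mul_nonneg hLc (by linarith)
  have h6 : 0 ≤ 2 / (L : ℝ) * (J + 1) := by positivity
  nlinarith

theorem eventually_sum_le {S : ℕ → Bool} (hL : 1 ≤ L)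
    (hR : ∀ j, (R j).length = blockLength L j)
    (hS : IsConcatenation S fun j => flagBlock (2 * L) (R j)) {v : ℕ} (hv : 0 < v) :
    ∀ᶠ n : ℕ in atTop, ∃ J,
      seqPrefix S n <+: blockPrefix (fun j => flagBlock (2 * L) (R j)) J ∧
      ((∑ j ∈ Finset.range J, ((R j).length + 2 * L + 1 + (R j).length / v) : ℕ) : ℝ) ≤
        (1 / 2 + 1 / (v : ℝ)) * n := by
  -- The blocks cost about (1/2 + 1/(2v))n; the spare n/(2v) covers the flags and the unfinished
  -- last block once J ≥ 30v.
  filter_upwards [hS.eventually_between (30 * v)] with n h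
  obtain ⟨J, hJ, hn, -, -, hp⟩ := h
  refine ⟨J + 1, hp, ?_⟩
  have hsum : ∀ m : ℕ,
      ((∑ j ∈ Finset.range m, ((R j).length + 2 * L + 1 + (R j).length / v) : ℕ) : ℝ) ≤
        (1 + 1 / (v : ℝ)) * (2 * L * (m ^ 2 + 3 * m) + m) + (2 * L + 1) * m := by
    intro m
    induction m with
    | zero => simp
    | succ m ih =>
      rw [Finset.sum_range_succ, Nat.cast_add]
      refine (add_le_add ih le_rfl).trans ?_
      have h1 : (((R m).length / v : ℕ) : ℝ) ≤ (R m).length / v := Nat.cast_div_le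
      rw [hR, blockLength] at h1 ⊢
      push_cast at h1 ⊢
      rw [div_eq_mul_one_div] at h1
      nlinarith
  refine (hsum (J + 1)).trans ?_
  have hn' := (length_blockPrefix_flagBlock hR J).symm.trans_le (Nat.cast_le.2 hn)
  have hv' : (1 : ℝ) ≤ v := by exact_mod_cast hv
  have hu0 : 0 < 1 / (v : ℝ) := by positivity
  have hu1 : 1 / (v : ℝ) ≤ 1 := by rw [div_le_one (by linarith)]; exact hv'
  have hJ' : (30 : ℝ) * v ≤ J := by exact_mod_cast hJ
  have hJu : 30 ≤ 1 / (v : ℝ) * J := by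
    rw [one_div, inv_mul_eq_div, le_div_iff₀ (by linarith)]
    exact hJ'
  have hL' : (1 : ℝ) ≤ L := by exact_mod_cast hL
  refine le_trans ?_ (mul_le_mul_of_nonneg_left hn' (by positivity))
  push_cast
  generalize 1 / (v : ℝ) = u at *
  have hJ30 : (30 : ℝ) ≤ J := by nlinarith
  have h3 : 0 ≤ (L : ℝ) * J * (u * J - 30) := mul_nonneg (by positivity) (by linarith)
  have h4 : 0 ≤ (L : ℝ) * (J - 30) := mul_nonneg (by linarith) (by linarith)
  have h5 : 0 ≤ u * ((L : ℝ) * (J - 30)) := mul_nonneg hu0.le h4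
  have h6 : 0 ≤ u * ((J : ℝ) - 30) := mul_nonneg hu0.le (by linarith)
  have h7 : 0 ≤ ((L : ℝ) - 1) * J := mul_nonneg (by linarith) (by linarith)
  nlinarith

end Lengths

/-! ### Bounds for the constructed sequence -/

section Bounds

variable {L : ℕ} {R : ℕ → List Bool} {S : ℕ → Bool}

theorem PushdownCompressor.IsLossless.eventually_le_length_output {C : UPDC} (hC : C.IsLossless)
    (hL : 1 ≤ L) (hR : ∀ j, (R j).length = blockLength L j)
    (hS : IsConcatenation S fun j => flagBlock (2 * L) (R j))
    (hdec : ∀ (M : CounterMachine) (q q' : Fin M.N) (c : ℕ), ∀ᶠ j in atTop,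
      ∀ a < c * (j + 1) ^ 2, ∀ y : List Bool,
        M.decode q q' a y = R j ∨ M.decode q q' a y = (R j).reverse →
          codeLength L j ≤ y.length) :
    ∀ᶠ n : ℕ in atTop, (1 - 1 / (L : ℝ)) * n ≤ (C.output (seqPrefix S n)).length := by
  obtain ⟨M, s₀, W, hout, hW, hinj⟩ := hC.exists_counterMachine
  set B : ℕ → List Bool := fun j => flagBlock (2 * L) (R j) with hB
  -- The end states need no advice: there are finitely many pairs, so one threshold serves them all.
  have hev : ∀ᶠ j in atTop, ∀ q q' : Fin M.N,
      ∀ a < (W * (18 * L + 3) + 1) * (j + 1) ^ 2, ∀ y : List Bool,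
        M.decode q q' a y = R j ∨ M.decode q q' a y = (R j).reverse →
          codeLength L j ≤ y.length :=
    eventually_all.2 fun q => eventually_all.2 fun q' => hdec M q q' _
  obtain ⟨j₀, hj₀⟩ := eventually_atTop.1 hev
  have hone : ∀ j ≥ j₀, ∀ x, x.length + 1 ≤ (18 * L + 3) * (j + 1) ^ 2 →
      ∀ z, z = R j ∨ z = (R j).reverse →
        codeLength L j ≤ (M.outFrom (M.final s₀ x) z).length := by
    intro j hj x hx z hz
    refine hj₀ j hj (M.final s₀ x).1 (M.final (M.final s₀ x) z).1 (M.final s₀ x).2 ?_ _ ?_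
    · calc _ ≤ W * (x.length + 1) := hW x
        _ ≤ W * ((18 * L + 3) * (j + 1) ^ 2) := Nat.mul_le_mul_left _ hx
        _ < _ := by
          have : 0 < (j + 1) ^ 2 := by positivity
          rw [show (W * (18 * L + 3) + 1) * (j + 1) ^ 2 =
            W * ((18 * L + 3) * (j + 1) ^ 2) + (j + 1) ^ 2 by ring]
          omega
    · rw [CounterMachine.decode_outFrom (hinj x)]
      exact hz
  have hsum : ∀ J ≥ j₀, ∑ j ∈ Finset.Ico j₀ J, (2 * codeLength L j - 2) ≤
      (M.outFrom s₀ (blockPrefix B J)).length := by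
    intro J hJ
    induction J, hJ using Nat.le_induction with
    | base => simp
    | succ J hJ ih =>
      have hlen := length_blockPrefix_le hR J
      rw [← hB, blockPrefix_succ, List.length_append] at hlen
      have h1 := hone J hJ (blockPrefix B J) (by omega) (R J) (Or.inl rfl)
      -- The machine reads the mirror half in a configuration of its own, and the reversal is just
      -- as incompressible there.
      have h2 := hone J hJ (blockPrefix B J ++ (R J ++ List.replicate (2 * L) true)) (by
        refine le_trans ?_ hlen
        simp [B, flagBlock]) (R J).reverse (Or.inr rfl)
      rw [Finset.sum_Ico_succ_top hJ, blockPrefix_succ, CounterMachine.outFrom_append]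
      simp only [B, flagBlock] at h1 h2 ih ⊢
      rw [CounterMachine.final_append] at h2
      rw [CounterMachine.outFrom_append, CounterMachine.outFrom_append]
      simp only [List.length_append] at h1 h2 ih ⊢
      omega
  filter_upwards [eventually_le_sum_codeLength hL hR hS j₀] with n hn
  obtain ⟨J, hJ, ⟨z, hz⟩, hn⟩ := hn
  refine hn.trans (Nat.cast_le.2 ((hsum J hJ).trans ?_))
  rw [hout, ← hz, CounterMachine.outFrom_append, List.length_append]
  exact Nat.le_add_right _ _

theorem FST.eventually_le_length_of_run_eq (T : FST) (hL : 1 ≤ L)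
    (hR : ∀ j, (R j).length = blockLength L j)
    (hS : IsConcatenation S fun j => flagBlock (2 * L) (R j))
    (hdec : ∀ (q : Fin T.m) (c : ℕ), ∀ᶠ j in atTop, ∀ a < c * (j + 1) ^ 2, ∀ y : List Bool,
        T.factor q (blockLength L j) a y = R j ∨ T.factor q (blockLength L j) a y = (R j).reverse →
          codeLength L j ≤ y.length) :
    ∀ᶠ n : ℕ in atTop, ∀ y, T.run y = seqPrefix S n → (1 - 1 / (L : ℝ)) * n ≤ y.length := by
  obtain ⟨W, hW⟩ := T.exists_length_runFrom_le
  have hev : ∀ᶠ j in atTop, ∀ q : Fin T.m, ∀ a < (W * (8 * L + 1) + 1) * (j + 1) ^ 2,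
      ∀ y : List Bool,
        T.factor q (blockLength L j) a y = R j ∨ T.factor q (blockLength L j) a y = (R j).reverse →
          codeLength L j ≤ y.length := eventually_all.2 fun q => hdec q _
  obtain ⟨j₀, hj₀⟩ := eventually_atTop.1 hev
  have hone : ∀ j ≥ j₀, ∀ z, z = R j ∨ z = (R j).reverse → T.Needs z (codeLength L j) := by
    intro j hj z hz
    refine FST.needs_of_factor hW fun q a ha y hy => hj₀ j hj q a (ha.trans_le ?_) y ?_
    · have h1 : codeLength L j ≤ (8 * L + 1) * (j + 1) ^ 2 := by
        have : (4 * L - 2) * (j + 2) ≤ 4 * L * (j + 2) := Nat.mul_le_mul_right _ (by omega)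
        have h2 : 4 * L * (j + 2) ≤ 4 * L * (2 * (j + 1) ^ 2) :=
          Nat.mul_le_mul_left _ (by nlinarith)
        have h3 : 0 < (j + 1) ^ 2 := by positivity
        rw [codeLength]
        nlinarith
      have h2 := Nat.mul_le_mul_left W h1
      have : 0 < (j + 1) ^ 2 := by positivity
      rw [add_mul, mul_assoc]
      omega
    · have hz' : z.length = blockLength L j := by
        rcases hz with rfl | rfl <;> simp [hR]
      rw [← hz', hy]
      exact hz
  have hsum : ∀ J ≥ j₀, T.Needs (blockPrefix (fun j => flagBlock (2 * L) (R j)) J)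
      (∑ j ∈ Finset.Ico j₀ J, (2 * codeLength L j - 2)) := by
    intro J hJ
    induction J, hJ using Nat.le_induction with
    | base => simpa using FST.Needs.zero T _
    | succ J hJ ih =>
      rw [Finset.sum_Ico_succ_top hJ, blockPrefix_succ]
      -- The flag is attached to the first half, leaving one cut inside the block and one before it.
      have h1 := (hone J hJ (R J) (Or.inl rfl)).mono
        (List.prefix_append _ (List.replicate (2 * L) true)).isInfix le_rfl
      have h2 := h1.append (c := 2 * codeLength L J - 1) (hone J hJ _ (Or.inr rfl)) (by
        rw [codeLength]
        omega)
      exact ih.append h2 (by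
        rw [codeLength]
        omega)
  filter_upwards [eventually_le_sum_codeLength hL hR hS j₀] with n hn y hy
  obtain ⟨J, hJ, hp, hn⟩ := hn
  refine hn.trans (Nat.cast_le.2 (hsum J hJ T.init y ?_))
  rw [← FST.run, hy]
  exact hp.isInfix

theorem le_fsComplexity {k n : ℕ} {x : List Bool} {c : ℝ}
    (h : ∀ T : FST, T.size ≤ k → ∀ y, T.run y = x → c * n ≤ y.length) :
    ∀ m : ℕ, fsComplexity k x = m → c * n ≤ m := by
  intro m hm
  by_contra! hlt
  have : ((m + 1 : ℕ) : ℕ∞) ≤ fsComplexity k x := le_iInf₂ fun y hy => by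
    obtain ⟨T, hT, hy⟩ := hy
    have h1 : (m : ℝ) < y.length := hlt.trans_le (h T hT y hy)
    exact_mod_cast h1
  rw [hm] at this
  norm_cast at this
  omega

/-- One k refutes depth: with the identity available the first complexity is at most n. Only
finitely many transducers have size at most k', so the lower bound holds for all of them from a
common n on. -/
theorem not_FSDepthGE {β : ℝ} (hβ : 1 / (L : ℝ) < β)
    (h : ∀ T : FST, ∀ᶠ n : ℕ in atTop, ∀ y, T.run y = seqPrefix S n →
      (1 - 1 / (L : ℝ)) * n ≤ y.length) : ¬ FSDepthGE S β := by
  intro hd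
  obtain ⟨k, hk⟩ := FST.exists_identity_size_le
  obtain ⟨k', hk'⟩ := hd k
  have hall : ∀ᶠ n : ℕ in atTop, ∀ T ∈ {T : FST | T.size ≤ k'}, ∀ y, T.run y = seqPrefix S n →
      (1 - 1 / (L : ℝ)) * n ≤ y.length := (FST.finite_size_le k').eventually_all.2 fun T _ => h T
  obtain ⟨n, hn, hT, hpos⟩ := (hk'.and_eventually (hall.and (eventually_gt_atTop 0))).exists
  have ha : fsComplexity k (seqPrefix S n) ≤ n :=
    (iInf₂_le (seqPrefix S n) ⟨FST.identity, hk, FST.identity_run _⟩).trans_eq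
      (by rw [length_seqPrefix])
  have hb := le_fsComplexity hT
  obtain ⟨a, ha'⟩ := ENat.ne_top_iff_exists.1 (ne_top_of_le_ne_top (ENat.natCast_ne_top n) ha)
  rw [← ha'] at hn ha
  have han : (a : ℝ) ≤ n := by exact_mod_cast ha
  have hn0 : (0 : ℝ) < n := by exact_mod_cast hpos
  induction hm : fsComplexity k' (seqPrefix S n) using ENat.recTopCoe with
  -- The first complexity is finite, so the difference is ⊥ and cannot exceed a real number.
  | top =>
    rw [hm] at hn
    simp only [ENat.toENNReal_top, EReal.coe_ennreal_top, EReal.sub_top, le_bot_iff] at hn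
    exact EReal.coe_ne_bot _ hn
  | coe m =>
    have hm' := hb m hm
    rw [hm] at hn
    have hn' : β * n ≤ (a : ℝ) - m := by
      have e : ∀ i : ℕ, ((((i : ℕ∞) : ℝ≥0∞)) : EReal) = ((i : ℝ) : EReal) := by
        intro i
        rw [ENat.toENNReal_coe, ← ENNReal.ofReal_natCast, EReal.coe_ennreal_ofReal,
          max_eq_left (Nat.cast_nonneg i)]
      rw [e, e, ← EReal.coe_sub, EReal.coe_le_coe_iff] at hn
      exact hn
    nlinarith

theorem palCompressor_eventually_length_le (hL : 1 ≤ L) (v : ℕ) [NeZero v] [NeZero (2 * L)]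
    (hR : ∀ j, (R j).length = blockLength L j)
    (hS : IsConcatenation S fun j => flagBlock (2 * L) (R j))
    (hrun : ∀ j, ¬ List.replicate (2 * L) true <:+: R j) (hend : ∀ j, ∃ y, R j = y ++ [false]) :
    ∀ᶠ n : ℕ in atTop, (((palCompressor (2 * L) v).output (seqPrefix S n)).length : ℝ) ≤
      (1 / 2 + 1 / (v : ℝ)) * n := by
  have hsum : ∀ J, PalState.IsRest (PalState.final ((.lit 0, []) : PalState (2 * L) v × List Bool)
        (blockPrefix (fun j => flagBlock (2 * L) (R j)) J)) ∧
      (PalState.out ((.lit 0, []) : PalState (2 * L) v × List Bool)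
        (blockPrefix (fun j => flagBlock (2 * L) (R j)) J)).length ≤
      ∑ j ∈ Finset.range J, ((R j).length + 2 * L + 1 + (R j).length / v) := by
    intro J
    induction J with
    | zero => exact ⟨⟨rfl, Or.inl rfl⟩, le_rfl⟩
    | succ J ih =>
      obtain ⟨h1, h2⟩ := ih.1.flagBlock (hrun J) (hend J)
      rw [blockPrefix_succ, PalState.final_append, PalState.out_append, List.length_append,
        Finset.sum_range_succ]
      exact ⟨h1, add_le_add ih.2 h2⟩
  filter_upwards [eventually_sum_le hL hR hS (Nat.pos_of_neZero v)] with n hn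
  obtain ⟨J, ⟨z, hz⟩, hn⟩ := hn
  refine le_trans (Nat.cast_le.2 (le_trans ?_ (hsum J).2)) hn
  -- Output only grows, so an unfinished block is charged as a complete one.
  rw [palCompressor_output, ← hz, PalState.out_append, List.length_append]
  exact Nat.le_add_right _ _

theorem ofReal_le_rhoUPD {c : ℝ} (h : ∀ C : UPDC, C.IsLossless → ∀ᶠ n : ℕ in atTop,
    c * n ≤ (C.output (seqPrefix S n)).length) : ENNReal.ofReal c ≤ rhoUPD S := by
  refine le_iInf₂ fun C hC => le_liminf_of_le (by isBoundedDefault) ?_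
  filter_upwards [h C hC, eventually_gt_atTop 0] with n hn hpos
  rw [ENNReal.le_div_iff_mul_le (Or.inl (by exact_mod_cast hpos.ne'))
    (Or.inl (ENNReal.natCast_ne_top n)), ← ENNReal.ofReal_natCast n, mul_comm,
    ← ENNReal.ofReal_mul (Nat.cast_nonneg n), mul_comm]
  exact ENNReal.ofReal_le_of_le_toReal (by simpa using hn)

theorem upperRatioPD_le {c : ℝ} (hc : 0 ≤ c) {C : PDC} (hC : C.IsLossless)
    (h : ∀ᶠ n : ℕ in atTop, ((C.output (seqPrefix S n)).length : ℝ) ≤ c * n) :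
    upperRatioPD S ≤ ENNReal.ofReal c := by
  refine (iInf₂_le C hC).trans (limsup_le_of_le (by isBoundedDefault) ?_)
  filter_upwards [h, eventually_gt_atTop 0] with n hn hpos
  rw [ENNReal.div_le_iff_le_mul (Or.inl (by exact_mod_cast hpos.ne'))
    (Or.inl (ENNReal.natCast_ne_top n)), ← ENNReal.ofReal_natCast n, ← ENNReal.ofReal_mul hc,
    ← ENNReal.ofReal_natCast]
  exact ENNReal.ofReal_le_ofReal hn

end Bounds

theorem mainTheorem2 (β : ℝ) (hβ0 : 0 < β) (hβ1 : β < 1 / 2) :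
    ∃ (S : ℕ → Bool) (k : ℕ) (R : ℕ → List Bool),
      PDDepthGE S (1 / 2 - β) ∧
      ¬ FSDepthGE S β ∧
      8 < k ∧ (8 : ℝ) / k ≤ β ∧
      IsConcatenation S (fun j => flagBlock k (R j)) ∧
      Tendsto (fun j => (R j).length) atTop atTop ∧
      (∀ j, ¬ List.replicate k true <:+: R j) ∧
      (∀ j, ENNReal.ofReal ((R j).length * (1 - 1 / (k : ℝ))) ≤
        ((plainComplexity (R j) : ℕ∞) : ℝ≥0∞)) ∧
      ENNReal.ofReal (1 - 6 / (k : ℝ)) < rhoUPD S ∧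
      upperRatioPD S ≤ 1 / 2 := by
  obtain ⟨L, hL8, hLβ⟩ : ∃ L : ℕ, 8 ≤ L ∧ 4 / β ≤ L := by
    obtain ⟨m, hm⟩ := exists_nat_ge (4 / β)
    exact ⟨m + 8, by omega, hm.trans (by push_cast; linarith)⟩
  have hL' : (8 : ℝ) ≤ L := by exact_mod_cast hL8
  have hLpos : (0 : ℝ) < L := by linarith
  have h4 : 4 / (L : ℝ) ≤ β := by
    rw [div_le_iff₀ hβ0] at hLβ
    rw [div_le_iff₀ hLpos]
    linarith
  have h41 : 4 / (L : ℝ) = 4 * (1 / L) := by ring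
  have hLinv : 0 < 1 / (L : ℝ) := by positivity
  have hLinv1 : 1 / (L : ℝ) ≤ 1 / 8 := one_div_le_one_div_of_le (by norm_num) hL'
  -- One countable family holds both kinds of decoders; the advice is a counter value for the first
  -- and a position in the output for the second.
  let D : ((Σ M : CounterMachine, Fin M.N × Fin M.N) ⊕ (Σ T : FST, Fin T.m)) →
      ℕ → ℕ → List Bool → List Bool
    | .inl z, _, a, y => z.1.decode z.2.1 z.2.2 a y
    | .inr z, j, a, y => z.1.factor z.2 (blockLength L j) a y
  have : Nonempty ((Σ M : CounterMachine, Fin M.N × Fin M.N) ⊕ (Σ T : FST, Fin T.m)) :=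
    ⟨.inr ⟨FST.identity, FST.identity.init⟩⟩
  obtain ⟨R, hR, hD⟩ := exists_incompressible_words (by omega : 3 ≤ L) D
  have hlen : ∀ j, (R j).length = blockLength L j :=
    fun j => length_of_mem_candidateWords (hR j).1
  have hrun : ∀ j, ¬ List.replicate (2 * L) true <:+: R j :=
    fun j => candidateWords_no_infix (by omega) (hR j).1
  have hend : ∀ j, ∃ y, R j = y ++ [false] := fun j => candidateWords_ends_false (hR j).1
  obtain ⟨S, hS⟩ := exists_isConcatenation (B := fun j => flagBlock (2 * L) (R j)) fun j => by
    obtain ⟨y, hy⟩ := hend j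
    simp [flagBlock, hy]
  have hlow : ∀ C : UPDC, C.IsLossless → ∀ᶠ n : ℕ in atTop,
      (1 - 1 / (L : ℝ)) * n ≤ (C.output (seqPrefix S n)).length := fun C hC =>
    hC.eventually_le_length_output (by omega) hlen hS fun M q q' c => hD (.inl ⟨M, q, q'⟩) c
  have : NeZero (2 * L) := ⟨by omega⟩
  have hup : ∀ v : ℕ, [NeZero v] → ∀ᶠ n : ℕ in atTop,
      (((palCompressor (2 * L) v).output (seqPrefix S n)).length : ℝ) ≤
        (1 / 2 + 1 / (v : ℝ)) * n := fun v _ =>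
    palCompressor_eventually_length_le (by omega) v hlen hS hrun hend
  refine ⟨S, 2 * L, R, fun C hC => ?_, ?_, by omega, ?_, hS, ?_, hrun, fun j => ?_, ?_, ?_⟩
  · have : NeZero L := ⟨by omega⟩
    -- With v = L the gap is (1 - 1/L) - (1/2 + 1/L) = 1/2 - 2/L, and 4/L ≤ β.
    refine ⟨palCompressor (2 * L) L, palCompressor_isLossless, ?_⟩
    filter_upwards [hlow C hC, hup L] with n h1 h2
    have hn : (0 : ℝ) ≤ n := Nat.cast_nonneg n
    nlinarith [mul_nonneg hn hLinv.le, mul_le_mul_of_nonneg_left h4 hn]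
  · exact not_FSDepthGE (by linarith) fun T =>
      T.eventually_le_length_of_run_eq (by omega) hlen hS fun q c => hD (.inr ⟨T, q⟩) c
  · push_cast
    refine le_trans (le_of_eq ?_) h4
    field_simp
    norm_num
  · simp only [hlen, blockLength]
    refine tendsto_atTop_mono (fun j => ?_) tendsto_id
    have : 1 * (j + 2) ≤ 4 * L * (j + 2) := Nat.mul_le_mul_right _ (by omega)
    simp only [id]
    omega
  · refine le_trans ?_ (ENat.toENNReal_le.2 (hR j).2)
    rw [ENat.toENNReal_coe]
    refine ENNReal.ofReal_le_of_le_toReal ?_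
    rw [hlen, blockLength, codeLength, ENNReal.toReal_natCast]
    push_cast [Nat.cast_sub (show 2 ≤ 4 * L by omega)]
    -- The right side is `codeLength` minus 1/(2L), so the required complexity is met with almost
    -- nothing to spare.
    have e : (4 * (L : ℝ) * (j + 2) + 1) * (1 - 1 / (2 * L)) =
        (4 * L - 2) * (j + 2) + 1 - 1 / L / 2 := by
      field_simp
      ring
    rw [e]
    linarith
  · refine lt_of_lt_of_le ?_ (ofReal_le_rhoUPD hlow)
    rw [ENNReal.ofReal_lt_ofReal_iff (by linarith)]
    push_cast
    have : 6 / (2 * (L : ℝ)) = 3 * (1 / L) := by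
      field_simp
      norm_num
    linarith
  -- No single compressor has to reach 1/2: the infimum does, as the buffer bound grows.
  · have hle : ∀ v : ℕ, upperRatioPD S ≤ ENNReal.ofReal (1 / 2 + 1 / ((v : ℝ) + 1)) := fun v => by
      have h := upperRatioPD_le (by positivity) (palCompressor_isLossless) (hup (v + 1))
      exact_mod_cast h
    refine ge_of_tendsto' (ENNReal.tendsto_ofReal (tendsto_one_div_add_atTop_nhds_zero_nat
      (𝕜 := ℝ).const_add (1 / 2))) hle |>.trans_eq ?_
    rw [add_zero, ENNReal.ofReal_div_of_pos two_pos]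
    simp
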